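/- Let $M_0\ge 0$, $M_1\ge 0$ and $\lambda\in\mathbb R$ satisfy $M_0M_1-\lambda^2\ge 0$, and suppose that the matrix $A=\begin{pmatrix}M_0&\lambda\\ \lambda&M_1\end{pmatrix}$ is not the zero matrix. For a real polynomial $P$ write $\mathbb P(0)=(P(0),P'(0))^t$, and let $(Q_n)_{n\ge0}$ be the monic polynomials, $\deg Q_n=n$, that are orthogonal with respect to the inner product $$(P,Q)=\int_{\mathbb R}P(x)Q(x)e^{-x^2}\,dx+\mathbb P(0)^tA\,\mathbb Q(0).$$ For real $\nu$ let $J_\nu(x)=\sum_{k\ge0}\frac{(-1)^k}{k!\,\Gamma(k+\nu+1)}\left(\frac x2\right)^{2k+\nu}$ be the Bessel function of the first kind; for $\nu+\frac12\in\{0,1,2,3\}$ the function $\left(\frac x2\right)^{1/2}J_\nu(x)$ extends from $\mathbb C\setminus\{0\}$ to an entire function, and it is understood in this sense below. Then the following limits hold as $n\to\infty$, uniformly for $x$ in compact subsets of $\mathbb C$. (a) Even degree. If $\lambda=0$, then $$\lim_{n\to\infty}\frac{(-1)^n\sqrt n}{n!}\,Q_{2n}\!\left(\frac{x}{2\sqrt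 n}\right)=\begin{cases}\left(\frac x2\right)^{1/2}J_{-1/2}(x)&\text{if }\operatorname{rank}A=1,\ M_0=0,\\[2pt]-\left(\frac x2\right)^{1/2}J_{3/2}(x)&\text{if }\operatorname{rank}A=1,\ M_0>0,\\[2pt]-\left(\frac x2\right)^{1/2}J_{3/2}(x)&\text{if }\operatorname{rank}A=2.\end{cases}$$ If $\lambda\ne0$, then $$\lim_{n\to\infty}\frac{(-1)^n\sqrt n}{n!}\,Q_{2n}\!\left(\frac{x}{2\sqrt n}\right)=\begin{cases}\left(\frac x2\right)^{1/2}J_{-1/2}(x)&\text{if }\operatorname{rank}A=1,\\[2pt]-\left(\frac x2\right)^{1/2}J_{3/2}(x)&\text{if }\operatorname{rank}A=2.\end{cases}$$ (b) Odd degree. If $\lambda=0$, then $$\lim_{n\to\infty}\frac{(-1)^n}{n!}\,Q_{2n+1}\!\left(\frac{x}{2\sqrt n}\right)=\begin{cases}\left(\frac x2\right)^{1/2}J_{1/2}(x)&\text{if }\operatorname{rank}A=1,\ M_1=0,\\[2pt]-\left(\frac x2\right)^{1/2}J_{5/2}(x)&\text{if }\operatorname{rank}A=1,\ M_1>0,\\[2pt]-\left(\frac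 x2\right)^{1/2}J_{5/2}(x)&\text{if }\operatorname{rank}A=2.\end{cases}$$ If $\lambda\ne0$, then $$\lim_{n\to\infty}\frac{(-1)^n}{n!}\,Q_{2n+1}\!\left(\frac{x}{2\sqrt n}\right)=-\left(\frac x2\right)^{1/2}J_{5/2}(x)$$ whether $\operatorname{rank}A=1$ or $\operatorname{rank}A=2$. -/

import Mathlib

open Filter Topology Polynomial
open scoped Nat

noncomputable section

/-- The symmetric matrix with diagonal entries `M₀`, `M₁` and off-diagonal entry `lam`. -/
def massMatrix (M₀ M₁ lam : ℝ) : Matrix (Fin 2) (Fin 2) ℝ :=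
  !![M₀, lam; lam, M₁]

/-- The vector `(P(0), P'(0))` attached to a real polynomial `P`. -/
def jetAtZero (P : ℝ[X]) : Fin 2 → ℝ :=
  ![P.eval 0, (derivative P).eval 0]

/-- The discrete Sobolev inner product
`∫ P(x) Q(x) e^{-x²} dx + (P(0), P'(0)) A (Q(0), Q'(0))ᵗ`. -/
def hermiteSobolevInner (A : Matrix (Fin 2) (Fin 2) ℝ) (P Q : ℝ[X]) : ℝ :=
  (∫ x : ℝ, P.eval x * Q.eval x * Real.exp (-x ^ 2)) +
    jetAtZero P ⬝ᵥ A.mulVec (jetAtZero Q)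

/-- `Q 0, Q 1, …` is the sequence of monic polynomials, `Q n` of degree `n`, which are orthogonal
with respect to the discrete Sobolev inner product given by `A`. -/
structure IsMonicOrthogonalSequence (A : Matrix (Fin 2) (Fin 2) ℝ) (Q : ℕ → ℝ[X]) : Prop where
  monic : ∀ n, (Q n).Monic
  natDegree_eq : ∀ n, (Q n).natDegree = n
  orthogonal : ∀ m n, m ≠ n → hermiteSobolevInner A (Q m) (Q n) = 0

/-- The Bessel function of the first kind of real order `ν` (principal branch of the power). At the
poles of the Gamma function the terms vanish, by the conventions `Γ(-k) = 0` and `1 / 0 = 0`. -/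
def besselJ (ν : ℝ) (z : ℂ) : ℂ :=
  ∑' n : ℕ, (-1 : ℂ) ^ n / ((n ! : ℂ) * Complex.Gamma ((n : ℂ) + (ν : ℂ) + 1)) *
    (z / 2) ^ (2 * (n : ℂ) + (ν : ℂ))

/-- The functions `F n` converge, uniformly on every compact subset of `ℂ`, to
`s * (x / 2) ^ (1 / 2) * J_ν(x)`, where the latter is read as an entire function: it is defined by
this formula for `x ≠ 0` and has a removable singularity at `x = 0`. -/
def ConvergesToBessel (F : ℕ → ℂ → ℂ) (s : ℂ) (ν : ℝ) : Prop :=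
  ∃ g : ℂ → ℂ, Differentiable ℂ g ∧
    (∀ x : ℂ, x ≠ 0 → g x = s * ((x / 2) ^ (1 / 2 : ℂ) * besselJ ν x)) ∧
    ∀ K : Set ℂ, IsCompact K → TendstoUniformlyOn F g atTop K

/-- `(-1)^n √n / n! * Q_{2n}(x / (2 √n))`. -/
def scaledEven (Q : ℕ → ℝ[X]) (n : ℕ) (x : ℂ) : ℂ :=
  (-1 : ℂ) ^ n * ((√(n : ℝ) : ℝ) : ℂ) / (n ! : ℂ) *
    aeval (x / (2 * ((√(n : ℝ) : ℝ) : ℂ))) (Q (2 * n))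

/-- `(-1)^n / n! * Q_{2n+1}(x / (2 √n))`. -/
def scaledOdd (Q : ℕ → ℝ[X]) (n : ℕ) (x : ℂ) : ℂ :=
  (-1 : ℂ) ^ n / (n ! : ℂ) *
    aeval (x / (2 * ((√(n : ℝ) : ℝ) : ℂ))) (Q (2 * n + 1))

end

/-! Let `H_k` be the monic Hermite polynomials, `h_k` their squared norms, and `q = (Q_N(0),
Q_N'(0))`. Orthogonality of `Q_N` to each `H_k` with `k < N` turns its Hermite coefficients into jet
pairings: `Q_N = H_N - ∑_{k<N} (jet(H_k)ᵗ A q / h_k) H_k`. Since `H_k` has the parity of `k`, the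
sum collapses to `α E + β O` with `(α, β) = A q`, where `E` and `O` are an even and an odd kernel
polynomial. Taking jets at 0 gives a 2×2 system for `q` with matrix `1 + diag(a, b) A`, where `a =
E(0)` and `b = O'(0)`. Its determinant `D = 1 + a M₀ + b M₁ + a b Δ`, `Δ = det A`, is positive, so
`Q_N` is explicit (`even_eq`, `odd_eq`).

The coefficients of `H_{2n}`, `H_{2n+1}`, `E` and `O` are closed expressions in falling factorials.
Under `x ↦ x / (2√n)` the normalised polynomials tend to `cos x`, `sin x`, `sin x / x` and `3 (sin x
- x cos x) / x²`, locally uniformly by dominated convergence; Wallis' product supplies the factor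
`1/√π`.

What remains is scalar. Here `a` has order `√n` and `b` order `n^(3/2)`, so the wrong-parity terms,
proportional to `λ`, vanish in the limit. The same-parity term carries a factor tending to some `B ∈
{0, 1}`. In even degree `B = 0` exactly when `Δ = 0` and `M₁ > 0`, because `b M₁` then dominates
`D`; in odd degree `B = 1` as soon as `M₁ > 0`. When `B = 1` the leading Taylor terms cancel, which
raises the Bessel index by 2. -/

noncomputable section

/-! ### Monic Hermite polynomials -/

/-- The monic Hermite polynomials, orthogonal for the weight `e^{-x²}`. -/
def monicHermite : ℕ → ℝ[X]
  | 0 => 1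
  | n + 1 => X * monicHermite n - C (1 / 2) * derivative (monicHermite n)

lemma monicHermite_zero : monicHermite 0 = 1 := rfl

lemma monicHermite_succ (n : ℕ) :
    monicHermite (n + 1) = X * monicHermite n - C (1 / 2) * derivative (monicHermite n) := rfl

lemma monicHermite_natDegree_monic (n : ℕ) :
    (monicHermite n).natDegree = n ∧ (monicHermite n).Monic := by
  induction n with
  | zero => simp [monicHermite_zero]
  | succ n ih =>
    obtain ⟨hd, hm⟩ := ih
    have h1 : (X * monicHermite n).natDegree = n + 1 := by
      rw [natDegree_X_mul hm.ne_zero, hd]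
    have h2 : (C (1 / 2 : ℝ) * derivative (monicHermite n)).degree
        < (X * monicHermite n).degree := by
      have hne : X * monicHermite n ≠ 0 := mul_ne_zero X_ne_zero hm.ne_zero
      rw [degree_eq_natDegree hne, h1]
      refine lt_of_le_of_lt degree_le_natDegree ?_
      have := (natDegree_C_mul_le (1 / 2 : ℝ) (derivative (monicHermite n))).trans
        ((natDegree_derivative_le _).trans (Nat.sub_le _ _))
      rw [hd] at this
      exact_mod_cast Nat.lt_succ_of_le this
    refine ⟨?_, (monic_X.mul hm).sub_of_left h2⟩
    rw [monicHermite_succ, natDegree_sub_eq_left_of_natDegree_lt, h1]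
    have hle := (natDegree_C_mul_le (1 / 2 : ℝ) (derivative (monicHermite n))).trans
      ((natDegree_derivative_le _).trans (Nat.sub_le _ _))
    omega

lemma monicHermite_natDegree (n : ℕ) : (monicHermite n).natDegree = n :=
  (monicHermite_natDegree_monic n).1

lemma monicHermite_monic (n : ℕ) : (monicHermite n).Monic :=
  (monicHermite_natDegree_monic n).2

lemma derivative_monicHermite_succ (n : ℕ) :
    derivative (monicHermite (n + 1)) = C ((n : ℝ) + 1) * monicHermite n := by
  induction n with
  | zero => simp [monicHermite]
  | succ n ih =>
    rw [monicHermite_succ (n + 1)]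
    simp only [derivative_sub, derivative_mul, derivative_X, derivative_C, ih, zero_mul, one_mul,
      zero_add]
    rw [monicHermite_succ n]
    push_cast
    simp only [C_add, C_1]
    ring

/-! ### Gaussian integration and Hermite orthogonality -/

lemma integrable_eval_mul_exp_neg_sq (P : ℝ[X]) :
    MeasureTheory.Integrable (fun x : ℝ => P.eval x * Real.exp (-x ^ 2)) := by
  induction P using Polynomial.induction_on' with
  | add p q hp hq =>
    simp only [eval_add, add_mul]
    exact hp.add hq
  | monomial n a =>
    have h := (integrable_rpow_mul_exp_neg_mul_sq one_pos
      (s := n) (by have := n.cast_nonneg (α := ℝ); linarith)).const_mul a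
    simpa [mul_assoc] using h

/-- Integration of a polynomial against the weight `e^{-x²}`. -/
def gaussFunctional : ℝ[X] →ₗ[ℝ] ℝ where
  toFun P := ∫ x : ℝ, P.eval x * Real.exp (-x ^ 2)
  map_add' P R := by
    simp only [eval_add, add_mul]
    exact MeasureTheory.integral_add (integrable_eval_mul_exp_neg_sq P)
      (integrable_eval_mul_exp_neg_sq R)
  map_smul' c P := by
    simp only [eval_smul, smul_eq_mul, mul_assoc, RingHom.id_apply]
    exact MeasureTheory.integral_const_mul _ _

lemma gaussFunctional_apply (P : ℝ[X]) :
    gaussFunctional P = ∫ x : ℝ, P.eval x * Real.exp (-x ^ 2) := rfl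

lemma gaussFunctional_one : gaussFunctional 1 = √Real.pi := by
  have h := integral_gaussian 1
  simpa [gaussFunctional_apply] using h

lemma gaussFunctional_C_mul (c : ℝ) (P : ℝ[X]) :
    gaussFunctional (C c * P) = c * gaussFunctional P := by
  rw [← smul_eq_C_mul, map_smul, smul_eq_mul]

lemma gaussFunctional_derivative (P : ℝ[X]) :
    gaussFunctional (derivative P) = 2 * gaussFunctional (X * P) := by
  have h : gaussFunctional (derivative P - C 2 * (X * P)) = 0 := by
    rw [gaussFunctional_apply]
    refine MeasureTheory.integral_eq_zero_of_hasDerivAt_of_integrable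
      (f := fun x : ℝ => P.eval x * Real.exp (-x ^ 2)) (fun x => ?_)
      (integrable_eval_mul_exp_neg_sq _) (integrable_eval_mul_exp_neg_sq _)
    have h2 : HasDerivAt (fun x : ℝ => Real.exp (-x ^ 2))
        (Real.exp (-x ^ 2) * (-(2 * x))) x := by
      have := ((hasDerivAt_pow 2 x).neg).exp
      simpa using! this
    have e : (derivative P - C 2 * (X * P)).eval x * Real.exp (-x ^ 2)
        = (derivative P).eval x * Real.exp (-x ^ 2)
          + P.eval x * (Real.exp (-x ^ 2) * (-(2 * x))) := by
      simp only [eval_sub, eval_mul, eval_C, eval_X]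
      ring
    rw [e]
    exact (P.hasDerivAt x).mul h2
  rw [map_sub, gaussFunctional_C_mul] at h
  linarith

/-- Integration by parts: the raising operator `P ↦ X P - P'/2` is adjoint to half the derivative.
Iterating this lowering yields both orthogonality and the norms. -/
lemma gaussFunctional_monicHermite_succ_mul (n : ℕ) (P : ℝ[X]) :
    gaussFunctional (monicHermite (n + 1) * P)
      = 1 / 2 * gaussFunctional (monicHermite n * derivative P) := by
  have h := gaussFunctional_derivative (monicHermite n * P)
  rw [derivative_mul, map_add] at h
  have e : monicHermite (n + 1) * P = X * (monicHermite n * P)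
      - C (1 / 2) * (derivative (monicHermite n) * P) := by
    rw [monicHermite_succ]; ring
  rw [e, map_sub, gaussFunctional_C_mul]
  linarith

/-- The squared norm of the monic Hermite polynomial of degree `n`. -/
def hermiteNormSq (n : ℕ) : ℝ := √Real.pi * n ! / 2 ^ n

lemma hermiteNormSq_pos (n : ℕ) : 0 < hermiteNormSq n := by
  unfold hermiteNormSq; positivity

lemma hermiteNormSq_succ (n : ℕ) :
    hermiteNormSq (n + 1) = (n + 1) / 2 * hermiteNormSq n := by
  unfold hermiteNormSq
  rw [Nat.factorial_succ, pow_succ]; push_cast; field_simp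

lemma gaussFunctional_monicHermite_mul (m n : ℕ) :
    gaussFunctional (monicHermite m * monicHermite n) = if m = n then hermiteNormSq n else 0 := by
  induction m generalizing n with
  | zero =>
    cases n with
    | zero => simp [monicHermite_zero, gaussFunctional_one, hermiteNormSq]
    | succ n => rw [mul_comm, gaussFunctional_monicHermite_succ_mul]; simp [monicHermite_zero]
  | succ m ih =>
    rw [gaussFunctional_monicHermite_succ_mul]
    cases n with
    | zero => simp [monicHermite_zero]
    | succ n =>
      rw [derivative_monicHermite_succ, mul_left_comm, gaussFunctional_C_mul, ih,
        hermiteNormSq_succ]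
      simp only [Nat.add_right_cancel_iff]
      split_ifs <;> ring

/-! ### Hermite expansion of the Sobolev orthogonal polynomials -/

/-- A monic sequence of polynomials graded by degree, as a `Polynomial.Sequence`. -/
def sequenceOfMonic (p : ℕ → ℝ[X]) (hm : ∀ n, (p n).Monic) (hd : ∀ n, (p n).natDegree = n) :
    Polynomial.Sequence ℝ where
  elems' := p
  degree_eq' n := by rw [degree_eq_natDegree (hm n).ne_zero, hd]

lemma mem_span_of_degree_lt {p : ℕ → ℝ[X]} (hm : ∀ n, (p n).Monic)
    (hd : ∀ n, (p n).natDegree = n) {N : ℕ} {P : ℝ[X]} (hP : P.degree < N) :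
    P ∈ Submodule.span ℝ (p '' Set.Iio N) := by
  have h := (sequenceOfMonic p hm hd).span_degreeLT (m := N)
    (fun i _ => by
      have : (p i).leadingCoeff = 1 := hm i
      change IsUnit (p i).leadingCoeff
      rw [this]; exact isUnit_one)
  change Submodule.span ℝ (p '' Set.Iio N) = _ at h
  rw [h]; exact Polynomial.mem_degreeLT.2 hP

lemma eq_sum_monicHermite {N : ℕ} {P : ℝ[X]} (hP : P.degree < N) :
    P = ∑ k ∈ Finset.range N,
      C (gaussFunctional (P * monicHermite k) / hermiteNormSq k) * monicHermite k := by
  have h := mem_span_of_degree_lt monicHermite_monic monicHermite_natDegree hP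
  clear hP
  induction h using Submodule.span_induction with
  | mem x hx =>
    obtain ⟨i, hi, rfl⟩ := hx
    have hi' : i ∈ Finset.range N := Finset.mem_range.2 hi
    rw [Finset.sum_eq_single_of_mem i hi']
    · rw [gaussFunctional_monicHermite_mul, if_pos rfl, div_self (hermiteNormSq_pos i).ne']; simp
    · intro b _ hb
      rw [gaussFunctional_monicHermite_mul, if_neg hb.symm]; simp
  | zero => simp
  | add x y _ _ hx hy =>
    conv_lhs => rw [hx, hy]
    rw [← Finset.sum_add_distrib]
    refine Finset.sum_congr rfl fun k _ => ?_
    rw [add_mul x y, map_add, add_div, C_add, add_mul]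
  | smul a x _ hx =>
    conv_lhs => rw [hx]
    rw [Finset.smul_sum]
    refine Finset.sum_congr rfl fun k _ => ?_
    rw [smul_mul_assoc, map_smul, smul_eq_mul, smul_eq_C_mul, ← mul_assoc, ← C_mul, mul_div_assoc]

lemma hermiteSobolevInner_eq (A : Matrix (Fin 2) (Fin 2) ℝ) (P R : ℝ[X]) :
    hermiteSobolevInner A P R
      = gaussFunctional (P * R) + jetAtZero P ⬝ᵥ A.mulVec (jetAtZero R) := by
  simp [hermiteSobolevInner, gaussFunctional_apply]

lemma jetAtZero_add (P R : ℝ[X]) : jetAtZero (P + R) = jetAtZero P + jetAtZero R := by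
  ext i; fin_cases i <;> simp [jetAtZero]

lemma jetAtZero_smul (c : ℝ) (P : ℝ[X]) : jetAtZero (c • P) = c • jetAtZero P := by
  ext i; fin_cases i <;> simp [jetAtZero]

lemma jetAtZero_zero : jetAtZero 0 = 0 := by
  ext i; fin_cases i <;> simp [jetAtZero]

lemma IsMonicOrthogonalSequence.inner_eq_zero {A : Matrix (Fin 2) (Fin 2) ℝ} {Q : ℕ → ℝ[X]}
    (hQ : IsMonicOrthogonalSequence A Q) {N : ℕ} {P : ℝ[X]} (hP : P.degree < N) :
    hermiteSobolevInner A P (Q N) = 0 := by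
  have h := mem_span_of_degree_lt hQ.monic hQ.natDegree_eq hP
  clear hP
  induction h using Submodule.span_induction with
  | mem x hx =>
    obtain ⟨i, hi, rfl⟩ := hx
    exact hQ.orthogonal i N (ne_of_lt hi)
  | zero => simp [hermiteSobolevInner_eq, jetAtZero_zero]
  | add x y _ _ hx hy =>
    rw [hermiteSobolevInner_eq] at *
    rw [add_mul, map_add, jetAtZero_add, add_dotProduct]; linarith
  | smul a x _ hx =>
    rw [hermiteSobolevInner_eq] at *
    rw [smul_mul_assoc, map_smul, jetAtZero_smul, smul_dotProduct, ← smul_add, hx, smul_zero]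

/-- The Hermite expansion of the orthogonal polynomials, in terms of their own jets at `0`. -/
lemma IsMonicOrthogonalSequence.eq_monicHermite_sub_sum {M₀ M₁ lam : ℝ} {Q : ℕ → ℝ[X]}
    (hQ : IsMonicOrthogonalSequence (massMatrix M₀ M₁ lam) Q) (N : ℕ) :
    Q N = monicHermite N - ∑ k ∈ Finset.range N,
      C (((M₀ * (Q N).eval 0 + lam * (derivative (Q N)).eval 0) * (monicHermite k).eval 0
        + (lam * (Q N).eval 0 + M₁ * (derivative (Q N)).eval 0)
          * (derivative (monicHermite k)).eval 0) / hermiteNormSq k) * monicHermite k := by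
  have hdeg : (Q N - monicHermite N).degree < N := by
    have h1 : (Q N).degree = N := by
      rw [degree_eq_natDegree (hQ.monic N).ne_zero, hQ.natDegree_eq]
    have h2 : (monicHermite N).degree = N := by
      rw [degree_eq_natDegree (monicHermite_monic N).ne_zero, monicHermite_natDegree]
    have h3 := degree_sub_lt_left (h1.trans h2.symm) (hQ.monic N).ne_zero
      ((hQ.monic N).leadingCoeff.trans (monicHermite_monic N).leadingCoeff.symm)
    rwa [h1] at h3
  have h := eq_sum_monicHermite hdeg
  rw [sub_eq_iff_eq_add'] at h
  rw [sub_eq_add_neg, ← Finset.sum_neg_distrib]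
  conv_lhs => rw [h]
  congr 1
  refine Finset.sum_congr rfl fun k hk => ?_
  have hk' := Finset.mem_range.1 hk
  have hkd : (monicHermite k).degree < N := by
    rw [degree_eq_natDegree (monicHermite_monic k).ne_zero, monicHermite_natDegree]
    exact_mod_cast hk'
  -- Orthogonality to `H_k` trades the Gaussian coefficient of `Q N` for minus its discrete pairing
  -- with `H_k`.
  have h0 := hQ.inner_eq_zero hkd
  rw [hermiteSobolevInner_eq] at h0
  rw [sub_mul, map_sub, gaussFunctional_monicHermite_mul, if_neg hk'.ne', mul_comm (Q N),
    ← neg_mul, ← C_neg, sub_zero, ← neg_div]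
  congr 3
  simp [jetAtZero, massMatrix, Matrix.mulVec, dotProduct, Fin.sum_univ_two] at h0
  linarith

/-! ### Taylor coefficients of the Hermite polynomials at 0 -/

lemma cast_descFactorial_succ_right (n j : ℕ) :
    (n.descFactorial (j + 1) : ℝ) = ((n : ℝ) - j) * n.descFactorial j := by
  rw [Nat.descFactorial_succ]
  rcases le_or_gt j n with h | h
  · push_cast [Nat.cast_sub h]; ring
  · rw [Nat.descFactorial_of_lt h]; simp

/-- The subtraction is taken in `ℝ` so that the identity persists for `j > n`, where truncated
subtraction would be delicate. -/
lemma cast_succ_descFactorial (n j : ℕ) :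
    ((n : ℝ) + 1 - j) * (n + 1).descFactorial j = (n + 1) * n.descFactorial j := by
  have h := cast_descFactorial_succ_right (n + 1) j
  rw [Nat.succ_descFactorial_succ] at h
  push_cast at h
  linarith

/-- `binom(2n, n) / 4^n`. -/
def centralBinomRatio (n : ℕ) : ℝ := n.centralBinom / 4 ^ n

lemma centralBinomRatio_pos (n : ℕ) : 0 < centralBinomRatio n := by
  have := n.centralBinom_pos
  unfold centralBinomRatio; positivity

lemma centralBinomRatio_succ (n : ℕ) :
    (2 * n + 2) * centralBinomRatio (n + 1) = (2 * n + 1) * centralBinomRatio n := by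
  have h : ((n : ℝ) + 1) * (n + 1).centralBinom = 2 * (2 * n + 1) * n.centralBinom := by
    exact_mod_cast n.succ_mul_centralBinom_succ
  unfold centralBinomRatio
  rw [pow_succ]
  field_simp
  linarith

lemma factorial_two_mul_eq (n : ℕ) :
    ((2 * n)! : ℝ) = centralBinomRatio n * 4 ^ n * (n ! : ℝ) ^ 2 := by
  have h : (((2 * n).choose n * n ! * (2 * n - n)! : ℕ) : ℝ) = (2 * n)! := by
    exact_mod_cast Nat.choose_mul_factorial_mul_factorial (by omega : n ≤ 2 * n)
  rw [show 2 * n - n = n by omega] at h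
  push_cast at h
  rw [← h, centralBinomRatio, Nat.centralBinom]
  field_simp

/-- The value at `0` of the monic Hermite polynomial of degree `2 * n`. -/
def hermiteValue (n : ℕ) : ℝ := (-1) ^ n * n ! * centralBinomRatio n

lemma hermiteValue_succ (n : ℕ) : hermiteValue (n + 1) = -((2 * n + 1) / 2 * hermiteValue n) := by
  have h := centralBinomRatio_succ n
  unfold hermiteValue
  rw [pow_succ, Nat.factorial_succ]
  push_cast
  linear_combination (-(1 / 2) * (-1) ^ n * (n ! : ℝ)) * h

lemma cast_factorial_succ (n : ℕ) : ((n + 1)! : ℝ) = (n + 1) * n ! := by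
  exact_mod_cast Nat.factorial_succ n

lemma coeff_monicHermite_even_odd (n : ℕ) :
    (∀ j, (monicHermite (2 * n)).coeff (2 * j)
      = hermiteValue n * ((-4) ^ j / (2 * j)! * n.descFactorial j)) ∧
    (∀ j, (monicHermite (2 * n)).coeff (2 * j + 1) = 0) ∧
    (∀ j, (monicHermite (2 * n + 1)).coeff (2 * j + 1)
      = (2 * n + 1) * hermiteValue n * ((-4) ^ j / (2 * j + 1)! * n.descFactorial j)) ∧
    (∀ j, (monicHermite (2 * n + 1)).coeff (2 * j) = 0) := by
  -- The recurrence gives the odd degree `2n+1` from the even degree `2n`, so the induction only has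
  -- to pass from `2n+1` to `2n+2`.
  have odd_of_even : ∀ n : ℕ, (∀ j, (monicHermite (2 * n)).coeff (2 * j)
      = hermiteValue n * ((-4) ^ j / (2 * j)! * n.descFactorial j)) →
      (∀ j, (monicHermite (2 * n)).coeff (2 * j + 1) = 0) →
      (∀ j, (monicHermite (2 * n + 1)).coeff (2 * j + 1)
      = (2 * n + 1) * hermiteValue n * ((-4) ^ j / (2 * j + 1)! * n.descFactorial j)) ∧
      (∀ j, (monicHermite (2 * n + 1)).coeff (2 * j) = 0) := by
    intro n h1 h2
    refine ⟨fun j => ?_, fun j => ?_⟩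
    · rw [monicHermite_succ, coeff_sub, coeff_X_mul, coeff_C_mul, coeff_derivative,
        show 2 * j + 1 + 1 = 2 * (j + 1) by ring, h1, h1, cast_descFactorial_succ_right,
        show 2 * (j + 1) = 2 * j + 1 + 1 by ring, cast_factorial_succ (2 * j + 1),
        cast_factorial_succ (2 * j)]
      push_cast
      field_simp
      ring
    · rw [monicHermite_succ, coeff_sub, coeff_C_mul, coeff_derivative, h2]
      cases j with
      | zero => simp
      | succ j => rw [show 2 * (j + 1) = 2 * j + 1 + 1 by ring, coeff_X_mul, h2]; simp
  induction n with
  | zero =>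
    have h1 : ∀ j, (monicHermite (2 * 0)).coeff (2 * j)
        = hermiteValue 0 * ((-4) ^ j / (2 * j)! * (0 : ℕ).descFactorial j) := by
      intro j
      cases j with
      | zero => simp [monicHermite, hermiteValue, centralBinomRatio]
      | succ j => simp [monicHermite, coeff_one]
    have h2 : ∀ j, (monicHermite (2 * 0)).coeff (2 * j + 1) = 0 := by
      intro j; simp [monicHermite, coeff_one]
    exact ⟨h1, h2, odd_of_even 0 h1 h2⟩
  | succ n ih =>
    obtain ⟨-, -, h3, h4⟩ := ih
    have h1 : ∀ j, (monicHermite (2 * (n + 1))).coeff (2 * j)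
        = hermiteValue (n + 1) * ((-4) ^ j / (2 * j)! * (n + 1).descFactorial j) := by
      intro j
      rw [show 2 * (n + 1) = 2 * n + 1 + 1 by ring, monicHermite_succ, coeff_sub, coeff_C_mul,
        coeff_derivative, h3, hermiteValue_succ]
      cases j with
      | zero => simp; ring
      | succ j =>
        rw [show 2 * (j + 1) = 2 * j + 1 + 1 by ring, coeff_X_mul, h3,
          cast_factorial_succ (2 * j + 1 + 1), cast_factorial_succ (2 * j + 1),
          cast_descFactorial_succ_right n, Nat.succ_descFactorial_succ]
        push_cast
        field_simp
        ring
    have h2 : ∀ j, (monicHermite (2 * (n + 1))).coeff (2 * j + 1) = 0 := by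
      intro j
      rw [show 2 * (n + 1) = 2 * n + 1 + 1 by ring, monicHermite_succ, coeff_sub, coeff_C_mul,
        coeff_derivative, coeff_X_mul, show 2 * j + 1 + 1 = 2 * (j + 1) by ring, h4, h4]
      simp
    exact ⟨h1, h2, odd_of_even (n + 1) h1 h2⟩

lemma eval_zero_monicHermite_even (n : ℕ) : (monicHermite (2 * n)).eval 0 = hermiteValue n := by
  have h := (coeff_monicHermite_even_odd n).1 0
  rw [← coeff_zero_eq_eval_zero]
  simpa using h

lemma eval_zero_monicHermite_odd (n : ℕ) : (monicHermite (2 * n + 1)).eval 0 = 0 := by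
  rw [← coeff_zero_eq_eval_zero]
  exact (coeff_monicHermite_even_odd n).2.2.2 0

lemma eval_zero_derivative (P : ℝ[X]) : (derivative P).eval 0 = P.coeff 1 := by
  rw [← coeff_zero_eq_eval_zero, coeff_derivative]; simp

lemma eval_zero_derivative_monicHermite_even (n : ℕ) :
    (derivative (monicHermite (2 * n))).eval 0 = 0 := by
  rw [eval_zero_derivative]
  exact (coeff_monicHermite_even_odd n).2.1 0

lemma eval_zero_derivative_monicHermite_odd (n : ℕ) :
    (derivative (monicHermite (2 * n + 1))).eval 0 = (2 * n + 1) * hermiteValue n := by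
  rw [eval_zero_derivative]
  simpa using (coeff_monicHermite_even_odd n).2.2.1 0

/-! ### Kernel polynomials of the Hermite weight -/

/-- The kernel polynomial `K_{2n-1}(x, 0)` of the Hermite weight. -/
def evenKernel (n : ℕ) : ℝ[X] :=
  ∑ k ∈ Finset.range n, C (hermiteValue k / hermiteNormSq (2 * k)) * monicHermite (2 * k)

/-- The derivative `∂_y K_{2n}(x, y)` at `y = 0` of the kernel of the Hermite weight. -/
def oddKernel (n : ℕ) : ℝ[X] :=
  ∑ k ∈ Finset.range n,
    C ((2 * k + 1) * hermiteValue k / hermiteNormSq (2 * k + 1)) * monicHermite (2 * k + 1)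

lemma hermiteValue_div_mul (k : ℕ) :
    hermiteValue k / hermiteNormSq (2 * k) * hermiteValue k = centralBinomRatio k / √Real.pi := by
  have h1 : (0 : ℝ) < √Real.pi := Real.sqrt_pos.2 Real.pi_pos
  have h2 := centralBinomRatio_pos k
  have h3 : (0 : ℝ) < k ! := by positivity
  have h4 : ((-1 : ℝ) ^ k) ^ 2 = 1 := by rw [← pow_mul, mul_comm, pow_mul]; simp
  unfold hermiteNormSq hermiteValue
  rw [factorial_two_mul_eq, pow_mul, show (2 : ℝ) ^ 2 = 4 by norm_num]
  field_simp
  rw [h4]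

/-- The value at `0` of `evenKernel (n + 1)`. -/
def evenKernelValue (n : ℕ) : ℝ := (2 * n + 1) * centralBinomRatio n / √Real.pi

/-- The derivative at `0` of `oddKernel (n + 1)`. -/
def oddKernelValue (n : ℕ) : ℝ := 2 / 3 * (2 * n + 3) * evenKernelValue n

lemma evenKernelValue_pos (n : ℕ) : 0 < evenKernelValue n := by
  have h1 : (0 : ℝ) < √Real.pi := Real.sqrt_pos.2 Real.pi_pos
  have := centralBinomRatio_pos n
  unfold evenKernelValue; positivity

lemma oddKernelValue_pos (n : ℕ) : 0 < oddKernelValue n := by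
  have := evenKernelValue_pos n
  unfold oddKernelValue; positivity

lemma evenKernelValue_succ (n : ℕ) :
    (2 * n + 2) * evenKernelValue (n + 1) = (2 * n + 3) * evenKernelValue n := by
  have h := centralBinomRatio_succ n
  unfold evenKernelValue
  push_cast
  linear_combination ((2 * n + 3) / √Real.pi) * h

/-- The sum telescopes coefficientwise: after removing common factors the induction step is
`2(n+1-j) + (2j+1) = 2n+3`. -/
lemma coeff_evenKernel_even (n j : ℕ) : (evenKernel (n + 1)).coeff (2 * j)
    = evenKernelValue n * ((-4) ^ j / (2 * j + 1)! * n.descFactorial j) := by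
  induction n with
  | zero =>
    have h := hermiteValue_div_mul 0
    simp only [evenKernel, zero_add, Finset.range_one, Finset.sum_singleton, coeff_C_mul]
    rw [(coeff_monicHermite_even_odd 0).1 j, ← mul_assoc, h, evenKernelValue]
    cases j with
    | zero => simp
    | succ j => simp
  | succ n ih =>
    have h := hermiteValue_div_mul (n + 1)
    have hc := centralBinomRatio_succ n
    have hd := cast_succ_descFactorial n j
    rw [evenKernel, Finset.sum_range_succ, ← evenKernel, coeff_add, ih, coeff_C_mul,
      (coeff_monicHermite_even_odd (n + 1)).1 j,
      ← mul_assoc (hermiteValue _ / _), h, cast_factorial_succ,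
      evenKernelValue, evenKernelValue]
    -- Both the central binomial ratio and the falling factorial are moved to index `n+1`, leaving a
    -- rational identity.
    have hc' : centralBinomRatio n = (2 * n + 2) / (2 * n + 1) * centralBinomRatio (n + 1) := by
      field_simp; linarith
    have hd' : (n.descFactorial j : ℝ) = ((n : ℝ) + 1 - j) / (n + 1) * (n + 1).descFactorial j := by
      field_simp; linarith
    rw [hc', hd']
    push_cast
    field_simp
    ring

lemma coeff_evenKernel_odd (n j : ℕ) : (evenKernel n).coeff (2 * j + 1) = 0 := by
  simp [evenKernel, (coeff_monicHermite_even_odd _).2.1]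

lemma coeff_oddKernel_even (n j : ℕ) : (oddKernel n).coeff (2 * j) = 0 := by
  simp [oddKernel, (coeff_monicHermite_even_odd _).2.2.2]

/-- The factor `3(2j+2)/(2j+3)!` equals 1 at `j = 0`, so `oddKernelValue n` is the derivative at 0.
The induction step reduces to `2(n+1-j) + (2j+3) = 2n+5`. -/
lemma coeff_oddKernel_odd (n j : ℕ) : (oddKernel (n + 1)).coeff (2 * j + 1)
    = oddKernelValue n
      * ((-4) ^ j * (3 * (2 * j + 2)) / (2 * j + 3)! * n.descFactorial j) := by
  have hk : ∀ k : ℕ, (2 * k + 1) * hermiteValue k / hermiteNormSq (2 * k + 1)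
      * ((2 * k + 1) * hermiteValue k) = 2 * (2 * k + 1) * (centralBinomRatio k / √Real.pi) := by
    intro k
    have hpos := hermiteNormSq_pos (2 * k)
    rw [← hermiteValue_div_mul, hermiteNormSq_succ]
    push_cast
    field_simp
  induction n with
  | zero =>
    have h := hk 0
    simp only [oddKernel, zero_add, Finset.range_one, Finset.sum_singleton, coeff_C_mul]
    rw [(coeff_monicHermite_even_odd 0).2.2.1 j, ← mul_assoc, h, oddKernelValue, evenKernelValue]
    cases j with
    | zero => simp [Nat.factorial]; ring
    | succ j => simp
  | succ n ih =>
    have hc := centralBinomRatio_succ n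
    have hd := cast_succ_descFactorial n j
    rw [oddKernel, Finset.sum_range_succ, ← oddKernel, coeff_add, ih, coeff_C_mul,
      (coeff_monicHermite_even_odd (n + 1)).2.2.1 j, ← mul_assoc (_ / _), hk (n + 1),
      cast_factorial_succ (2 * j + 2), cast_factorial_succ (2 * j + 1),
      oddKernelValue, oddKernelValue, evenKernelValue, evenKernelValue]
    have hc' : centralBinomRatio n = (2 * n + 2) / (2 * n + 1) * centralBinomRatio (n + 1) := by
      field_simp; linarith
    have hd' : (n.descFactorial j : ℝ) = ((n : ℝ) + 1 - j) / (n + 1) * (n + 1).descFactorial j := by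
      field_simp; linarith
    rw [hc', hd']
    push_cast
    field_simp
    ring

lemma eval_zero_evenKernel (n : ℕ) : (evenKernel (n + 1)).eval 0 = evenKernelValue n := by
  rw [← coeff_zero_eq_eval_zero]
  simpa using coeff_evenKernel_even n 0

lemma eval_zero_derivative_evenKernel (n : ℕ) : (derivative (evenKernel n)).eval 0 = 0 := by
  rw [eval_zero_derivative]; exact coeff_evenKernel_odd n 0

lemma eval_zero_oddKernel (n : ℕ) : (oddKernel n).eval 0 = 0 := by
  rw [← coeff_zero_eq_eval_zero]; exact coeff_oddKernel_even n 0

lemma eval_zero_derivative_oddKernel (n : ℕ) :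
    (derivative (oddKernel (n + 1))).eval 0 = oddKernelValue n := by
  rw [eval_zero_derivative]
  have h := coeff_oddKernel_odd n 0
  rw [show 2 * 0 + 1 = 1 by rfl] at h
  rw [h]; simp [Nat.factorial]; norm_num

lemma sum_range_two_mul_eq {M : Type*} [AddCommMonoid M] (f : ℕ → M) (n : ℕ) :
    ∑ k ∈ Finset.range (2 * n), f k
      = ∑ k ∈ Finset.range n, f (2 * k) + ∑ k ∈ Finset.range n, f (2 * k + 1) := by
  induction n with
  | zero => simp
  | succ n ih =>
    rw [show 2 * (n + 1) = 2 * n + 1 + 1 by ring, Finset.sum_range_succ, Finset.sum_range_succ, ih,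
      Finset.sum_range_succ, Finset.sum_range_succ]
    abel

lemma sum_kernel_even (α β : ℝ) (n : ℕ) :
    ∑ k ∈ Finset.range n, C ((α * (monicHermite (2 * k)).eval 0
        + β * (derivative (monicHermite (2 * k))).eval 0) / hermiteNormSq (2 * k))
          * monicHermite (2 * k) = C α * evenKernel n := by
  rw [evenKernel, Finset.mul_sum]
  refine Finset.sum_congr rfl fun k _ => ?_
  rw [eval_zero_monicHermite_even, eval_zero_derivative_monicHermite_even, ← mul_assoc, ← C_mul,
    mul_zero, add_zero, mul_div_assoc]

lemma sum_kernel_odd (α β : ℝ) (n : ℕ) :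
    ∑ k ∈ Finset.range n, C ((α * (monicHermite (2 * k + 1)).eval 0
        + β * (derivative (monicHermite (2 * k + 1))).eval 0) / hermiteNormSq (2 * k + 1))
          * monicHermite (2 * k + 1) = C β * oddKernel n := by
  rw [oddKernel, Finset.mul_sum]
  refine Finset.sum_congr rfl fun k _ => ?_
  rw [eval_zero_monicHermite_odd, eval_zero_derivative_monicHermite_odd, ← mul_assoc (C β), ← C_mul,
    mul_zero, zero_add, mul_div_assoc]

/-! ### Explicit formulas for the orthogonal polynomials -/

/-- The determinant of `1 + diag(a, b) * A`. -/
def kernelDet (M₀ M₁ lam a b : ℝ) : ℝ := 1 + a * M₀ + b * M₁ + a * b * (M₀ * M₁ - lam ^ 2)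

lemma kernelDet_pos {M₀ M₁ lam a b : ℝ} (hM₀ : 0 ≤ M₀) (hM₁ : 0 ≤ M₁)
    (hdet : 0 ≤ M₀ * M₁ - lam ^ 2) (ha : 0 ≤ a) (hb : 0 ≤ b) :
    0 < kernelDet M₀ M₁ lam a b := by
  unfold kernelDet; positivity

section Explicit

variable {M₀ M₁ lam : ℝ} {Q : ℕ → ℝ[X]}

/-- Cramer's rule for the jet `q` of `Q (2(n+1))`, which solves `(1 + diag(a, b) A) q = (H(0), 0)`;
the kernel coefficients are the entries of `A q`. -/
lemma IsMonicOrthogonalSequence.even_eq (hM₀ : 0 ≤ M₀) (hM₁ : 0 ≤ M₁)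
    (hdet : 0 ≤ M₀ * M₁ - lam ^ 2)
    (hQ : IsMonicOrthogonalSequence (massMatrix M₀ M₁ lam) Q) (n : ℕ) :
    Q (2 * (n + 1)) = monicHermite (2 * (n + 1))
      - C (hermiteValue (n + 1) * (M₀ + oddKernelValue n * (M₀ * M₁ - lam ^ 2))
          / kernelDet M₀ M₁ lam (evenKernelValue n) (oddKernelValue n)) * evenKernel (n + 1)
      - C (hermiteValue (n + 1) * lam
          / kernelDet M₀ M₁ lam (evenKernelValue n) (oddKernelValue n)) * oddKernel (n + 1) := by
  have h := hQ.eq_monicHermite_sub_sum (2 * (n + 1))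
  rw [sum_range_two_mul_eq, sum_kernel_even, sum_kernel_odd] at h
  have hD := kernelDet_pos hM₀ hM₁ hdet (evenKernelValue_pos n).le (oddKernelValue_pos n).le
  have h0 := congrArg (eval 0) h
  have h1 := congrArg (fun P => eval 0 (derivative P)) h
  simp only [eval_sub, eval_add, eval_mul, eval_C, derivative_sub, derivative_add,
    derivative_C_mul, eval_zero_monicHermite_even, eval_zero_derivative_monicHermite_even,
    eval_zero_evenKernel, eval_zero_derivative_evenKernel, eval_zero_oddKernel,
    eval_zero_derivative_oddKernel] at h0 h1
  set q₀ := (Q (2 * (n + 1))).eval 0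
  set q₁ := (derivative (Q (2 * (n + 1)))).eval 0
  set a := evenKernelValue n
  set b := oddKernelValue n
  rw [h, ← sub_sub]
  congr 3
  · congr 1
    rw [eq_div_iff hD.ne', kernelDet]
    -- The multipliers here and below are the rows of `A · adj(1 + diag(a, b) A)`.
    linear_combination (M₀ + b * (M₀ * M₁ - lam ^ 2)) * h0 + lam * h1
  · rw [eq_div_iff hD.ne', kernelDet]
    linear_combination lam * h0 + (M₁ + a * (M₀ * M₁ - lam ^ 2)) * h1

lemma IsMonicOrthogonalSequence.odd_eq (hM₀ : 0 ≤ M₀) (hM₁ : 0 ≤ M₁)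
    (hdet : 0 ≤ M₀ * M₁ - lam ^ 2)
    (hQ : IsMonicOrthogonalSequence (massMatrix M₀ M₁ lam) Q) (n : ℕ) :
    Q (2 * (n + 1) + 1) = monicHermite (2 * (n + 1) + 1)
      - C ((2 * (n + 1 : ℕ) + 1) * hermiteValue (n + 1) * lam
          / kernelDet M₀ M₁ lam (evenKernelValue (n + 1)) (oddKernelValue n)) * evenKernel (n + 2)
      - C ((2 * (n + 1 : ℕ) + 1) * hermiteValue (n + 1)
            * (M₁ + evenKernelValue (n + 1) * (M₀ * M₁ - lam ^ 2))
          / kernelDet M₀ M₁ lam (evenKernelValue (n + 1)) (oddKernelValue n))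
            * oddKernel (n + 1) := by
  have h := hQ.eq_monicHermite_sub_sum (2 * (n + 1) + 1)
  -- There are `n+2` even and `n+1` odd indices below `2(n+1)+1`; the extra even term is merged into
  -- the even sum, whence `evenKernel (n + 2)`.
  rw [Finset.sum_range_succ, sum_range_two_mul_eq, add_right_comm,
    ← Finset.sum_range_succ (fun k => C (((M₀ * (Q (2 * (n + 1) + 1)).eval 0
        + lam * (derivative (Q (2 * (n + 1) + 1))).eval 0) * (monicHermite (2 * k)).eval 0
        + (lam * (Q (2 * (n + 1) + 1)).eval 0 + M₁ * (derivative (Q (2 * (n + 1) + 1))).eval 0)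
          * (derivative (monicHermite (2 * k))).eval 0) / hermiteNormSq (2 * k))
            * monicHermite (2 * k)), sum_kernel_even, sum_kernel_odd] at h
  have hD := kernelDet_pos hM₀ hM₁ hdet (evenKernelValue_pos (n + 1)).le (oddKernelValue_pos n).le
  have h0 := congrArg (eval 0) h
  have h1 := congrArg (fun P => eval 0 (derivative P)) h
  simp only [eval_sub, eval_add, eval_mul, eval_C, derivative_sub, derivative_add,
    derivative_C_mul, eval_zero_monicHermite_odd, eval_zero_derivative_monicHermite_odd,
    eval_zero_evenKernel, eval_zero_derivative_evenKernel, eval_zero_oddKernel,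
    eval_zero_derivative_oddKernel] at h0 h1
  set q₀ := (Q (2 * (n + 1) + 1)).eval 0
  set q₁ := (derivative (Q (2 * (n + 1) + 1))).eval 0
  set a := evenKernelValue (n + 1)
  set b := oddKernelValue n
  rw [h, ← sub_sub]
  congr 3
  · congr 1
    rw [eq_div_iff hD.ne', kernelDet]
    linear_combination (M₀ + b * (M₀ * M₁ - lam ^ 2)) * h0 + lam * h1
  · rw [eq_div_iff hD.ne', kernelDet]
    linear_combination lam * h0 + (M₁ + a * (M₀ * M₁ - lam ^ 2)) * h1

end Explicit

/-! ### Entire series of fixed parity and their convergence -/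

/-- The power series with coefficients `c j` at the exponents `2 * j + p`. -/
def paritySeries (c : ℕ → ℝ) (p : ℕ) (x : ℂ) : ℂ := ∑' j, (c j : ℂ) * x ^ (2 * j + p)

lemma summable_bound (R : ℝ) (p : ℕ) :
    Summable fun j : ℕ => 3 / (j ! : ℝ) * R ^ (2 * j + p) := by
  have h := ((Real.summable_pow_div_factorial (R ^ 2)).mul_left (3 * R ^ p))
  refine h.congr fun j => ?_
  rw [pow_add, pow_mul]; ring

lemma summable_paritySeries {c : ℕ → ℝ} (hc : ∀ j, |c j| ≤ 3 / j !) (p : ℕ) (x : ℂ) :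
    Summable fun j => (c j : ℂ) * x ^ (2 * j + p) := by
  refine Summable.of_norm_bounded (summable_bound ‖x‖ p) fun j => ?_
  rw [norm_mul, norm_pow, Complex.norm_real, Real.norm_eq_abs]
  gcongr
  exact hc j

lemma abs_mul_le_of_abs_le_one {a b w : ℝ} (ha : |a| ≤ b) (hw : |w| ≤ 1) : |a * w| ≤ b := by
  rw [abs_mul]
  nlinarith [abs_nonneg a, abs_nonneg w]

/-- For `‖x‖ ≤ |R|` the error is at most `∑ 3/j! |R|^(2j+p) |1 - w n j|`, independent of `x`, and
this tends to 0 by dominated convergence. -/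
lemma tendstoUniformlyOn_paritySeries {c : ℕ → ℝ} {w : ℕ → ℕ → ℝ} (p : ℕ)
    (hc : ∀ j, |c j| ≤ 3 / j !) (hw : ∀ n j, |w n j| ≤ 1)
    (hlim : ∀ j, Tendsto (fun n => w n j) atTop (𝓝 1)) {K : Set ℂ} (hK : IsCompact K) :
    TendstoUniformlyOn (fun n => paritySeries (fun j => c j * w n j) p) (paritySeries c p)
      atTop K := by
  obtain ⟨R, hR⟩ := hK.isBounded.subset_closedBall 0
  have hx : ∀ x ∈ K, ‖x‖ ≤ |R| := fun x hx =>
    (mem_closedBall_zero_iff.1 (hR hx)).trans (le_abs_self R)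
  have hbound : ∀ n j, ‖3 / (j ! : ℝ) * |R| ^ (2 * j + p) * |1 - w n j|‖
      ≤ 3 / (j ! : ℝ) * |R| ^ (2 * j + p) * 2 := by
    intro n j
    rw [Real.norm_of_nonneg (by positivity)]
    have : |1 - w n j| ≤ 2 := by
      have := abs_le.1 (hw n j)
      exact abs_le.2 ⟨by linarith, by linarith⟩
    gcongr
  have hsum := (summable_bound |R| p).mul_right 2
  have hT : Tendsto (fun n => ∑' j : ℕ, 3 / (j ! : ℝ) * |R| ^ (2 * j + p) * |1 - w n j|)
      atTop (𝓝 (∑' _ : ℕ, (0 : ℝ))) := by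
    refine tendsto_tsum_of_dominated_convergence hsum (fun j => ?_)
      (Eventually.of_forall fun n j => hbound n j)
    have h1 : Tendsto (fun n => |1 - w n j|) atTop (𝓝 |1 - 1|) := ((hlim j).const_sub 1).abs
    simpa using h1.const_mul (3 / (j ! : ℝ) * |R| ^ (2 * j + p))
  rw [tsum_zero] at hT
  rw [Metric.tendstoUniformlyOn_iff]
  intro ε hε
  filter_upwards [hT.eventually (gt_mem_nhds hε)] with n hn x hxK
  refine lt_of_le_of_lt ?_ hn
  have hs1 := summable_paritySeries hc p x
  have hs2 := summable_paritySeries (c := fun j => c j * w n j)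
    (fun j => abs_mul_le_of_abs_le_one (hc j) (hw n j)) p x
  rw [dist_eq_norm, paritySeries, paritySeries, ← hs1.tsum_sub hs2]
  refine tsum_of_norm_bounded
    (Summable.of_norm_bounded hsum fun j => hbound n j).hasSum fun j => ?_
  have e : (c j : ℂ) * x ^ (2 * j + p) - ((c j * w n j : ℝ) : ℂ) * x ^ (2 * j + p)
      = (c j : ℂ) * x ^ (2 * j + p) * ((1 - w n j : ℝ) : ℂ) := by push_cast; ring
  rw [e, norm_mul, norm_mul, norm_pow, Complex.norm_real, Complex.norm_real, Real.norm_eq_abs,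
    Real.norm_eq_abs]
  have := hx x hxK
  gcongr
  exact hc j

lemma differentiable_paritySeries {c : ℕ → ℝ} (hc : ∀ j, |c j| ≤ 3 / j !) (p : ℕ) :
    Differentiable ℂ (paritySeries c p) := by
  rw [← differentiableOn_univ]
  refine TendstoLocallyUniformlyOn.differentiableOn
    -- Partial sums are the series with weights `1_{j<n}`, so the previous lemma gives their locally
    -- uniform convergence.
    (F := fun n => paritySeries (fun j => c j * if j < n then 1 else 0) p) ?_
    (Eventually.of_forall (f := atTop) fun n => ?_) isOpen_univ
  · rw [tendstoLocallyUniformlyOn_iff_forall_isCompact isOpen_univ]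
    intro K _ hK
    refine tendstoUniformlyOn_paritySeries (w := fun n j => if j < n then 1 else 0) p hc
      (fun n j => ?_) (fun j => ?_) hK
    · split_ifs <;> simp
    · refine tendsto_const_nhds.congr' ?_
      filter_upwards [eventually_gt_atTop j] with n hn
      rw [if_pos hn]
  · rw [differentiableOn_univ]
    have e : paritySeries (fun j => c j * if j < n then 1 else 0) p
        = fun x => ∑ j ∈ Finset.range n, (c j : ℂ) * x ^ (2 * j + p) := by
      ext x
      rw [paritySeries, tsum_eq_sum (s := Finset.range n)]
      · refine Finset.sum_congr rfl fun j hj => ?_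
        rw [if_pos (Finset.mem_range.1 hj), mul_one]
      · intro j hj
        rw [if_neg (by simpa using hj)]; simp
    rw [e]
    fun_prop

lemma paritySeries_sub {c d : ℕ → ℝ} (hc : ∀ j, |c j| ≤ 3 / j !) (hd : ∀ j, |d j| ≤ 3 / j !)
    (p : ℕ) (x : ℂ) :
    paritySeries c p x - paritySeries d p x = paritySeries (fun j => c j - d j) p x := by
  rw [paritySeries, paritySeries, paritySeries,
    ← (summable_paritySeries hc p x).tsum_sub (summable_paritySeries hd p x)]
  refine tsum_congr fun j => ?_
  push_cast; ring

lemma const_mul_paritySeries (a : ℝ) (c : ℕ → ℝ) (p : ℕ) (x : ℂ) :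
    (a : ℂ) * paritySeries c p x = paritySeries (fun j => a * c j) p x := by
  rw [paritySeries, paritySeries, ← tsum_mul_left]
  refine tsum_congr fun j => ?_
  push_cast; ring

lemma paritySeries_shift {c : ℕ → ℝ} (h0 : c 0 = 0) (p : ℕ) (x : ℂ) :
    paritySeries c p x = paritySeries (fun j => c (j + 1)) (p + 2) x := by
  rw [paritySeries, paritySeries,
    ← (add_left_injective 1).tsum_eq (f := fun j => (c j : ℂ) * x ^ (2 * j + p))]
  · refine tsum_congr fun j => ?_
    rw [show 2 * (j + 1) + p = 2 * j + (p + 2) by ring]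
  · intro j hj
    cases j with
    | zero => simp [h0] at hj
    | succ j => exact ⟨j, rfl⟩

/-- The scaling turns `4^j` into `1 / m^j`, which is the normalisation under which falling
factorials tend to 1. -/
lemma aeval_eq_paritySeries {P : ℝ[X]} {p : ℕ} {A m : ℝ} {c d : ℕ → ℝ} (hm : 0 < m)
    (h : ∀ j, P.coeff (2 * j + p) = A * (4 ^ j * c j * d j))
    (hz : ∀ i, i ∉ Set.range (fun j => 2 * j + p) → P.coeff i = 0) (x : ℂ) :
    aeval (x / (2 * ((√m : ℝ) : ℂ))) P
      = ((A / (2 * √m) ^ p : ℝ) : ℂ) * paritySeries (fun j => c j * (d j / m ^ j)) p x := by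
  set y := x / (2 * ((√m : ℝ) : ℂ)) with hy
  have h1 : aeval y P = ∑' i, (P.coeff i : ℂ) * y ^ i := by
    rw [aeval_eq_sum_range, tsum_eq_sum (s := Finset.range (P.natDegree + 1))]
    · exact Finset.sum_congr rfl fun i _ => by rw [Complex.real_smul]
    · intro i hi
      rw [coeff_eq_zero_of_natDegree_lt (by simpa using hi)]; simp
  have hinj : Function.Injective fun j : ℕ => 2 * j + p := fun a b hab => by
    simp only at hab; omega
  rw [h1, ← hinj.tsum_eq (f := fun i => (P.coeff i : ℂ) * y ^ i), paritySeries, ← tsum_mul_left]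
  · refine tsum_congr fun j => ?_
    have hs : ((√m : ℝ) : ℂ) ≠ 0 := by exact_mod_cast (Real.sqrt_pos.2 hm).ne'
    have hs2 : ((√m : ℝ) : ℂ) ^ 2 = m := by exact_mod_cast Real.sq_sqrt hm.le
    have hm' : (m : ℂ) ≠ 0 := by exact_mod_cast hm.ne'
    simp only [h, hy]
    push_cast
    rw [div_pow, pow_add (2 * ((√m : ℝ) : ℂ)), pow_mul (2 * ((√m : ℝ) : ℂ)), mul_pow _ _ 2, hs2,
      mul_pow _ _ j]
    norm_num
    field_simp
  · intro i hi
    by_contra hn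
    exact hi (by simp [hz i hn])

/-! ### Falling factorial weights and the Wallis product -/

lemma descFactorial_weight_abs_le {n m : ℕ} (h : n ≤ m) (j : ℕ) :
    |(n.descFactorial j : ℝ) / (m : ℝ) ^ j| ≤ 1 := by
  rw [abs_of_nonneg (by positivity)]
  refine div_le_one_of_le₀ ?_ (by positivity)
  calc (n.descFactorial j : ℝ) ≤ (n : ℝ) ^ j := by exact_mod_cast n.descFactorial_le_pow j
    _ ≤ (m : ℝ) ^ j := by gcongr

lemma tendsto_descFactorial_succ_weight (j : ℕ) :
    Tendsto (fun n : ℕ => ((n + 1).descFactorial j : ℝ) / ((n + 1 : ℕ) : ℝ) ^ j) atTop (𝓝 1) := by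
  have h : Tendsto (fun n : ℕ => (n.descFactorial j : ℝ) / (n : ℝ) ^ j) atTop (𝓝 1) := by
    refine (Asymptotics.isEquivalent_iff_tendsto_one ?_).1 (isEquivalent_descFactorial j)
    filter_upwards [eventually_gt_atTop 0] with n hn
    positivity
  exact h.comp (tendsto_add_atTop_nat 1)

/-- Needed for kernels whose falling factorial has index one below the scaling parameter; the
correction is `1 - j/(n+1)`. -/
lemma tendsto_descFactorial_weight (j : ℕ) :
    Tendsto (fun n : ℕ => (n.descFactorial j : ℝ) / ((n + 1 : ℕ) : ℝ) ^ j) atTop (𝓝 1) := by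
  have h1 : Tendsto (fun n : ℕ => 1 - (j : ℝ) / ((n + 1 : ℕ) : ℝ)) atTop (𝓝 (1 - 0)) :=
    ((tendsto_const_div_atTop_nhds_zero_nat (j : ℝ)).comp (tendsto_add_atTop_nat 1)).const_sub 1
  have h2 := h1.mul (tendsto_descFactorial_succ_weight j)
  rw [sub_zero, one_mul] at h2
  refine h2.congr fun n => ?_
  have hd := cast_succ_descFactorial n j
  have : (n.descFactorial j : ℝ) = ((n : ℝ) + 1 - j) / (n + 1) * (n + 1).descFactorial j := by
    field_simp; linarith
  rw [this]
  push_cast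
  field_simp

/-- `√n * binom(2n, n) / 4^n → 1 / √π`, a form of the Wallis product. -/
lemma tendsto_sqrt_mul_centralBinomRatio :
    Tendsto (fun n : ℕ => √(n : ℝ) * centralBinomRatio n) atTop (𝓝 (1 / √Real.pi)) := by
  -- The partial Wallis product is `1 / ((2n+1) c_n²)` with `c_n = binom(2n, n) / 4^n`.
  have hW : ∀ n : ℕ, Real.Wallis.W n * (centralBinomRatio n ^ 2 * (2 * n + 1)) = 1 := by
    intro n
    have := centralBinomRatio_pos n
    rw [Real.Wallis.W_eq_factorial_ratio, factorial_two_mul_eq, pow_mul,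
      show (2 : ℝ) ^ 4 = 4 ^ 2 by norm_num, ← pow_mul, mul_comm 2 n, pow_mul]
    field_simp
  have hq : Tendsto (fun n : ℕ => (n : ℝ) / (2 * n + 1)) atTop (𝓝 (1 / 2)) := by
    have h : Tendsto (fun n : ℕ => 1 / (2 + 1 / (n : ℝ))) atTop (𝓝 (1 / (2 + 0))) :=
      tendsto_const_nhds.div
        (tendsto_const_nhds.add (tendsto_const_div_atTop_nhds_zero_nat (1 : ℝ))) (by norm_num)
    rw [add_zero] at h
    refine h.congr' ?_
    filter_upwards [eventually_gt_atTop 0] with n hn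
    have : (0 : ℝ) < n := by exact_mod_cast hn
    field_simp
  have hdiv := (hq.div Real.Wallis.tendsto_W_nhds_pi_div_two (by positivity)).sqrt
  have e : √(1 / 2 / (Real.pi / 2)) = 1 / √Real.pi := by
    rw [show (1 : ℝ) / 2 / (Real.pi / 2) = 1 / Real.pi by field_simp, Real.sqrt_div zero_le_one,
      Real.sqrt_one]
  rw [e] at hdiv
  refine hdiv.congr fun n => ?_
  have hc := centralBinomRatio_pos n
  have hWn := Real.Wallis.W_pos n
  have : (n : ℝ) / (2 * n + 1) / Real.Wallis.W n = n * centralBinomRatio n ^ 2 := by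
    rw [div_div, div_eq_iff (by positivity)]
    linear_combination (-(n : ℝ)) * hW n
  simp only [Pi.div_apply, this]
  rw [Real.sqrt_mul (by positivity), Real.sqrt_sq hc.le]

/-! ### Half-integer Bessel functions and scaled building blocks -/

lemma gamma_add_half_eq (n : ℕ) :
    Real.Gamma (n + 1 / 2) = √Real.pi * n ! * centralBinomRatio n := by
  induction n with
  | zero => simp [centralBinomRatio, ← Real.Gamma_one_half_eq]
  | succ n ih =>
    have hc := centralBinomRatio_succ n
    rw [show ((n + 1 : ℕ) : ℝ) + 1 / 2 = (n + 1 / 2 : ℝ) + 1 by push_cast; ring,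
      Real.Gamma_add_one (by positivity), ih, cast_factorial_succ]
    linear_combination (-(1 / 2) * √Real.pi * (n ! : ℝ)) * hc

/-- The half-integer powers combine to the integer power `2k+p`, so the branch choice disappears; `x
≠ 0` is what allows the exponents to be added. -/
lemma sqrt_mul_besselJ_eq (p : ℕ) {ν : ℝ} (hν : ν = p - 1 / 2) {x : ℂ} (hx : x ≠ 0) :
    (x / 2) ^ (1 / 2 : ℂ) * besselJ ν x
      = paritySeries
        (fun k => (-1) ^ k / (k ! * Real.Gamma ((k + p : ℕ) + 1 / 2) * 2 ^ (2 * k + p))) p x := by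
  have hx2 : x / 2 ≠ 0 := div_ne_zero hx two_ne_zero
  rw [besselJ, paritySeries, ← tsum_mul_left]
  refine tsum_congr fun k => ?_
  have h1 : (x / 2) ^ (1 / 2 : ℂ) * (x / 2) ^ (2 * (k : ℂ) + (ν : ℂ)) = (x / 2) ^ (2 * k + p) := by
    rw [← Complex.cpow_add _ _ hx2, ← Complex.cpow_natCast]
    congr 1
    rw [hν]; push_cast; ring
  have h2 : Complex.Gamma ((k : ℂ) + (ν : ℂ) + 1)
      = ((Real.Gamma ((k + p : ℕ) + 1 / 2) : ℝ) : ℂ) := by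
    rw [← Complex.Gamma_ofReal]
    congr 1
    rw [hν]; push_cast; ring
  rw [h2, mul_left_comm, h1, div_pow]
  push_cast
  field_simp

/-- Taylor coefficients of `cos`. -/
def cosCoeff (j : ℕ) : ℝ := (-1) ^ j / (2 * j)!

/-- Taylor coefficients of `sin`, which are also those of `sin x / x`. -/
def sinCoeff (j : ℕ) : ℝ := (-1) ^ j / (2 * j + 1)!

/-- Taylor coefficients of `3 (sin x - x cos x) / x²`. -/
def oddKernelCoeff (j : ℕ) : ℝ := (-1) ^ j * (3 * (2 * j + 2)) / (2 * j + 3)!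

lemma abs_cosCoeff_le (j : ℕ) : |cosCoeff j| ≤ 3 / j ! := by
  have h : (j ! : ℝ) ≤ (2 * j)! := by exact_mod_cast Nat.factorial_le (by omega)
  rw [cosCoeff, abs_div, abs_pow, abs_neg, abs_one, one_pow, abs_of_nonneg (by positivity)]
  gcongr
  norm_num

lemma abs_sinCoeff_le (j : ℕ) : |sinCoeff j| ≤ 3 / j ! := by
  have h : (j ! : ℝ) ≤ (2 * j + 1)! := by exact_mod_cast Nat.factorial_le (by omega)
  rw [sinCoeff, abs_div, abs_pow, abs_neg, abs_one, one_pow, abs_of_nonneg (by positivity)]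
  gcongr
  norm_num

lemma abs_oddKernelCoeff_le (j : ℕ) : |oddKernelCoeff j| ≤ 3 / j ! := by
  have h : (j ! : ℝ) ≤ (2 * j + 1)! := by exact_mod_cast Nat.factorial_le (by omega)
  have hj : (0 : ℝ) < j ! := by positivity
  rw [oddKernelCoeff, abs_div, abs_mul, abs_pow, abs_neg, abs_one, one_pow, one_mul,
    abs_of_nonneg (by positivity), abs_of_nonneg (by positivity), cast_factorial_succ (2 * j + 2),
    cast_factorial_succ (2 * j + 1)]
  push_cast
  rw [div_le_div_iff₀ (by positivity) hj]
  have h1 : (3 : ℝ) * (2 * j + 2) * j ! ≤ 3 * (2 * j + 2) * (2 * j + 1)! := by gcongr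
  have h2 : (3 : ℝ) * (2 * j + 2) * (2 * j + 1)! * 1
      ≤ 3 * (2 * j + 2) * (2 * j + 1)! * (2 * j + 3) := by
    gcongr
    linarith [j.cast_nonneg (α := ℝ)]
  linarith

lemma neg_four_pow_factor (n : ℕ) (m : ℝ) (j : ℕ) (e : ℝ) :
    m * ((-4) ^ j / e * n.descFactorial j)
      = m * (4 ^ j * ((-1) ^ j / e) * n.descFactorial j) := by
  rw [show (-4 : ℝ) = 4 * (-1) by norm_num, mul_pow]; ring

lemma coeff_eq_zero_of_notMem_range_even {P : ℝ[X]} (h : ∀ j, P.coeff (2 * j + 1) = 0) (i : ℕ)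
    (hi : i ∉ Set.range fun j => 2 * j + 0) : P.coeff i = 0 := by
  rcases Nat.even_or_odd' i with ⟨k, rfl | rfl⟩
  · exact absurd ⟨k, rfl⟩ hi
  · exact h k

lemma coeff_eq_zero_of_notMem_range_odd {P : ℝ[X]} (h : ∀ j, P.coeff (2 * j) = 0) (i : ℕ)
    (hi : i ∉ Set.range fun j => 2 * j + 1) : P.coeff i = 0 := by
  rcases Nat.even_or_odd' i with ⟨k, rfl | rfl⟩
  · exact h k
  · exact absurd ⟨k, rfl⟩ hi

lemma aeval_monicHermite_even {m : ℝ} (hm : 0 < m) (n : ℕ) (x : ℂ) :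
    aeval (x / (2 * ((√m : ℝ) : ℂ))) (monicHermite (2 * n))
      = ((hermiteValue n : ℝ) : ℂ)
        * paritySeries (fun j => cosCoeff j * (n.descFactorial j / m ^ j)) 0 x := by
  have h := aeval_eq_paritySeries (p := 0) (c := cosCoeff) (d := fun j => n.descFactorial j) hm
    (fun j => ((coeff_monicHermite_even_odd n).1 j).trans (neg_four_pow_factor _ _ _ _))
    (coeff_eq_zero_of_notMem_range_even (coeff_monicHermite_even_odd n).2.1) x
  simpa using h

lemma aeval_monicHermite_odd {m : ℝ} (hm : 0 < m) (n : ℕ) (x : ℂ) :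
    aeval (x / (2 * ((√m : ℝ) : ℂ))) (monicHermite (2 * n + 1))
      = (((2 * n + 1) * hermiteValue n / (2 * √m) : ℝ) : ℂ)
        * paritySeries (fun j => sinCoeff j * (n.descFactorial j / m ^ j)) 1 x := by
  have h := aeval_eq_paritySeries (p := 1) (c := sinCoeff) (d := fun j => n.descFactorial j) hm
    (fun j => ((coeff_monicHermite_even_odd n).2.2.1 j).trans (neg_four_pow_factor _ _ _ _))
    (coeff_eq_zero_of_notMem_range_odd (coeff_monicHermite_even_odd n).2.2.2) x
  simpa using h

lemma aeval_evenKernel {m : ℝ} (hm : 0 < m) (n : ℕ) (x : ℂ) :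
    aeval (x / (2 * ((√m : ℝ) : ℂ))) (evenKernel (n + 1))
      = ((evenKernelValue n : ℝ) : ℂ)
        * paritySeries (fun j => sinCoeff j * (n.descFactorial j / m ^ j)) 0 x := by
  have h := aeval_eq_paritySeries (p := 0) (c := sinCoeff) (d := fun j => n.descFactorial j) hm
    (fun j => (coeff_evenKernel_even n j).trans (neg_four_pow_factor _ _ _ _))
    (coeff_eq_zero_of_notMem_range_even (coeff_evenKernel_odd (n + 1))) x
  simpa using h

lemma aeval_oddKernel {m : ℝ} (hm : 0 < m) (n : ℕ) (x : ℂ) :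
    aeval (x / (2 * ((√m : ℝ) : ℂ))) (oddKernel (n + 1))
      = ((oddKernelValue n / (2 * √m) : ℝ) : ℂ)
        * paritySeries (fun j => oddKernelCoeff j * (n.descFactorial j / m ^ j)) 1 x := by
  have h := aeval_eq_paritySeries (p := 1) (c := oddKernelCoeff)
    (d := fun j => n.descFactorial j) hm
    (fun j => (coeff_oddKernel_odd n j).trans (by
      rw [oddKernelCoeff, show (-4 : ℝ) = 4 * (-1) by norm_num, mul_pow]; ring))
    (coeff_eq_zero_of_notMem_range_odd (coeff_oddKernel_even (n + 1))) x
  simpa using h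

lemma tendsto_mul_paritySeries {a : ℕ → ℝ} {a₀ : ℝ} (ha : Tendsto a atTop (𝓝 a₀))
    {c : ℕ → ℝ} {w : ℕ → ℕ → ℝ} (p : ℕ)
    (hc : ∀ j, |c j| ≤ 3 / j !) (hw : ∀ n j, |w n j| ≤ 1)
    (hlim : ∀ j, Tendsto (fun n => w n j) atTop (𝓝 1)) {K : Set ℂ} (hK : IsCompact K) :
    TendstoUniformlyOn (fun n x => (a n : ℂ) * paritySeries (fun j => c j * w n j) p x)
      (fun x => (a₀ : ℂ) * paritySeries c p x) atTop K := by
  rw [← tendstoLocallyUniformlyOn_iff_tendstoUniformlyOn_of_compact hK]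
  have hF := (tendstoUniformlyOn_paritySeries p hc hw hlim hK).tendstoLocallyUniformlyOn
  have ha' : Tendsto (fun n => (a n : ℂ)) atTop (𝓝 (a₀ : ℂ)) :=
    (Complex.continuous_ofReal.tendsto a₀).comp ha
  exact (ha'.tendstoUniformlyOn_const K).tendstoLocallyUniformlyOn.mul₀ hF continuousOn_const
    (differentiable_paritySeries hc p).continuous.continuousOn

/-! ### Identification of the limits with Bessel functions -/

lemma paritySeries_congr {c d : ℕ → ℝ} (h : ∀ j, c j = d j) (p : ℕ) (x : ℂ) :
    paritySeries c p x = paritySeries d p x := by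
  rw [funext h]

lemma bessel_neg_half {x : ℂ} (hx : x ≠ 0) :
    ((1 / √Real.pi : ℝ) : ℂ) * paritySeries cosCoeff 0 x
      = (x / 2) ^ (1 / 2 : ℂ) * besselJ (-1 / 2) x := by
  rw [sqrt_mul_besselJ_eq 0 (by norm_num) hx, const_mul_paritySeries]
  refine paritySeries_congr (fun k => ?_) 0 x
  have := centralBinomRatio_pos k
  have hpi := Real.sqrt_pos.2 Real.pi_pos
  rw [add_zero, add_zero, gamma_add_half_eq, cosCoeff, factorial_two_mul_eq, pow_mul]
  norm_num
  field_simp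

lemma bessel_half {x : ℂ} (hx : x ≠ 0) :
    ((1 / √Real.pi : ℝ) : ℂ) * paritySeries sinCoeff 1 x
      = (x / 2) ^ (1 / 2 : ℂ) * besselJ (1 / 2) x := by
  rw [sqrt_mul_besselJ_eq 1 (by norm_num) hx, const_mul_paritySeries]
  refine paritySeries_congr (fun k => ?_) 1 x
  have := centralBinomRatio_pos k
  have hpi := Real.sqrt_pos.2 Real.pi_pos
  have hg : Real.Gamma ((k + 1 : ℕ) + 1 / 2) = (k + 1 / 2) * Real.Gamma (k + 1 / 2) := by
    rw [← Real.Gamma_add_one (by positivity)]; congr 1; push_cast; ring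
  rw [hg, gamma_add_half_eq, sinCoeff, cast_factorial_succ, factorial_two_mul_eq, pow_succ (2 : ℝ),
    pow_mul]
  push_cast
  norm_num
  field_simp

/-- The constant terms of `cos x` and `sin x / x` cancel, so the difference starts at `x²`, matching
index `2 - 1/2`. -/
lemma bessel_three_halves {x : ℂ} (hx : x ≠ 0) :
    ((1 / √Real.pi : ℝ) : ℂ) * (paritySeries cosCoeff 0 x - paritySeries sinCoeff 0 x)
      = -1 * ((x / 2) ^ (1 / 2 : ℂ) * besselJ (3 / 2) x) := by
  rw [sqrt_mul_besselJ_eq 2 (by norm_num) hx, paritySeries_sub abs_cosCoeff_le abs_sinCoeff_le,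
    paritySeries_shift (by simp [cosCoeff, sinCoeff]), const_mul_paritySeries,
    show (-1 : ℂ) = ((-1 : ℝ) : ℂ) by simp, const_mul_paritySeries]
  refine paritySeries_congr (fun k => ?_) _ x
  have := centralBinomRatio_pos k
  have hpi := Real.sqrt_pos.2 Real.pi_pos
  have hg : Real.Gamma ((k + 2 : ℕ) + 1 / 2)
      = (k + 3 / 2) * ((k + 1 / 2) * Real.Gamma (k + 1 / 2)) := by
    rw [← Real.Gamma_add_one (by positivity), show (k + 3 / 2 : ℝ) = k + 1 / 2 + 1 by ring,
      ← Real.Gamma_add_one (by positivity)]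
    congr 1; push_cast; ring
  rw [hg, gamma_add_half_eq, sinCoeff, cosCoeff, show 2 * (k + 1) = 2 * k + 1 + 1 by ring,
    cast_factorial_succ (2 * k + 1 + 1), cast_factorial_succ (2 * k + 1), cast_factorial_succ,
    factorial_two_mul_eq, pow_add (2 : ℝ), pow_mul (2 : ℝ), pow_succ (-1 : ℝ)]
  push_cast
  norm_num
  field_simp
  ring

/-- The linear terms cancel, so the difference starts at `x³`, matching index `3 - 1/2`. -/
lemma bessel_five_halves {x : ℂ} (hx : x ≠ 0) :
    ((1 / √Real.pi : ℝ) : ℂ) * (paritySeries sinCoeff 1 x - paritySeries oddKernelCoeff 1 x)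
      = -1 * ((x / 2) ^ (1 / 2 : ℂ) * besselJ (5 / 2) x) := by
  rw [sqrt_mul_besselJ_eq 3 (by norm_num) hx,
    paritySeries_sub abs_sinCoeff_le abs_oddKernelCoeff_le,
    paritySeries_shift (by simp [oddKernelCoeff, sinCoeff, Nat.factorial]; norm_num),
    const_mul_paritySeries,
    show (-1 : ℂ) = ((-1 : ℝ) : ℂ) by simp, const_mul_paritySeries]
  refine paritySeries_congr (fun k => ?_) _ x
  have := centralBinomRatio_pos k
  have hpi := Real.sqrt_pos.2 Real.pi_pos
  have hg : Real.Gamma ((k + 3 : ℕ) + 1 / 2)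
      = (k + 5 / 2) * ((k + 3 / 2) * ((k + 1 / 2) * Real.Gamma (k + 1 / 2))) := by
    rw [← Real.Gamma_add_one (by positivity), show (k + 3 / 2 : ℝ) = k + 1 / 2 + 1 by ring,
      ← Real.Gamma_add_one (by positivity), show (k + 5 / 2 : ℝ) = k + 1 / 2 + 1 + 1 by ring,
      ← Real.Gamma_add_one (by positivity)]
    congr 1; push_cast; ring
  rw [hg, gamma_add_half_eq, sinCoeff, oddKernelCoeff, show 2 * (k + 1) = 2 * k + 1 + 1 by ring,
    show 2 * k + 1 + 1 + 3 = 2 * k + 1 + 1 + 1 + 1 + 1 by ring,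
    cast_factorial_succ (2 * k + 1 + 1 + 1 + 1), cast_factorial_succ (2 * k + 1 + 1 + 1),
    cast_factorial_succ (2 * k + 1 + 1), cast_factorial_succ (2 * k + 1), cast_factorial_succ,
    factorial_two_mul_eq, pow_add (2 : ℝ), pow_mul (2 : ℝ), pow_succ (-1 : ℝ)]
  push_cast
  norm_num
  field_simp
  ring

/-! ### Asymptotics of the scalar factors -/

/-- Isolates the bounded Wallis factor, exhibiting growth of order `√n`. -/
lemma evenKernelValue_eq (n : ℕ) :
    evenKernelValue n
      = √((n + 1 : ℕ) : ℝ) * (2 / √Real.pi) * (√((n + 1 : ℕ) : ℝ) * centralBinomRatio (n + 1)) := by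
  have h := centralBinomRatio_succ n
  have hs := Real.mul_self_sqrt (Nat.cast_nonneg (α := ℝ) (n + 1))
  unfold evenKernelValue
  rw [← h]
  push_cast at hs ⊢
  linear_combination (-(2 / √Real.pi) * centralBinomRatio (n + 1)) * hs

lemma tendsto_sqrt_succ_atTop : Tendsto (fun n : ℕ => √((n + 1 : ℕ) : ℝ)) atTop atTop :=
  (Real.tendsto_sqrt_atTop.comp tendsto_natCast_atTop_atTop).comp (tendsto_add_atTop_nat 1)

lemma tendsto_evenKernelValue : Tendsto evenKernelValue atTop atTop := by
  have hpi := Real.sqrt_pos.2 Real.pi_pos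
  have h1 := tendsto_sqrt_mul_centralBinomRatio.comp (tendsto_add_atTop_nat 1)
  have h2 := (tendsto_sqrt_succ_atTop.atTop_mul_const
    (by positivity : 0 < 2 / √Real.pi)).atTop_mul_pos (by positivity : 0 < 1 / √Real.pi) h1
  exact h2.congr fun n => (evenKernelValue_eq n).symm

lemma evenKernelValue_le_oddKernelValue (n : ℕ) : evenKernelValue n ≤ oddKernelValue n := by
  have := evenKernelValue_pos n
  unfold oddKernelValue
  nlinarith [n.cast_nonneg (α := ℝ)]

lemma tendsto_oddKernelValue : Tendsto oddKernelValue atTop atTop :=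
  tendsto_atTop_mono evenKernelValue_le_oddKernelValue tendsto_evenKernelValue

lemma oddKernelValue_eq_succ (n : ℕ) :
    oddKernelValue n = 4 / 3 * ((n + 1 : ℕ) : ℝ) * evenKernelValue (n + 1) := by
  have h := evenKernelValue_succ n
  unfold oddKernelValue
  push_cast
  linear_combination (-(2 / 3)) * h

lemma tendsto_one_div_succ : Tendsto (fun n : ℕ => 1 / ((n + 1 : ℕ) : ℝ)) atTop (𝓝 0) :=
  (tendsto_const_div_atTop_nhds_zero_nat (1 : ℝ)).comp (tendsto_add_atTop_nat 1)

lemma tendsto_evenKernelValue_div :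
    Tendsto (fun n => evenKernelValue n / oddKernelValue n) atTop (𝓝 0) := by
  have h : ∀ n : ℕ, evenKernelValue n / oddKernelValue n ≤ 3 / 4 * (1 / ((n + 1 : ℕ) : ℝ)) := by
    intro n
    have := evenKernelValue_pos n
    unfold oddKernelValue
    push_cast
    rw [div_le_iff₀ (by positivity)]
    field_simp
    nlinarith
  have h0 := tendsto_one_div_succ.const_mul (3 / 4)
  rw [mul_zero] at h0
  exact squeeze_zero (fun n => (div_pos (evenKernelValue_pos n) (oddKernelValue_pos n)).le) h h0

section Scalars

variable {M₀ M₁ lam : ℝ}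

/-- After division by `a b`, only `Δ` survives in numerator and denominator. -/
lemma tendsto_even_factor_of_det_pos (hM₀ : 0 ≤ M₀) (hM₁ : 0 ≤ M₁)
    (hdet : 0 < M₀ * M₁ - lam ^ 2) :
    Tendsto (fun n => evenKernelValue n * (M₀ + oddKernelValue n * (M₀ * M₁ - lam ^ 2))
      / kernelDet M₀ M₁ lam (evenKernelValue n) (oddKernelValue n)) atTop (𝓝 1) := by
  have ia := tendsto_evenKernelValue.inv_tendsto_atTop
  have ib := tendsto_oddKernelValue.inv_tendsto_atTop
  set Δ := M₀ * M₁ - lam ^ 2 with hΔ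
  have h : Tendsto (fun n => ((oddKernelValue n)⁻¹ * M₀ + Δ) /
      ((evenKernelValue n)⁻¹ * (oddKernelValue n)⁻¹ + (oddKernelValue n)⁻¹ * M₀
        + (evenKernelValue n)⁻¹ * M₁ + Δ)) atTop (𝓝 ((0 * M₀ + Δ) / (0 * 0 + 0 * M₀ + 0 * M₁ + Δ))) :=
    ((ib.mul_const M₀).add_const Δ).div
      ((((ia.mul ib).add (ib.mul_const M₀)).add (ia.mul_const M₁)).add_const Δ)
      (by simpa using hdet.ne')
  rw [show (0 * M₀ + Δ) / (0 * 0 + 0 * M₀ + 0 * M₁ + Δ) = 1 by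
    simp only [zero_mul, zero_add]; exact div_self hdet.ne'] at h
  refine h.congr fun n => ?_
  have ha := evenKernelValue_pos n
  have hb := oddKernelValue_pos n
  rw [kernelDet, ← hΔ, div_eq_div_iff (by positivity) (by positivity)]
  field_simp

lemma tendsto_even_factor_of_pos (hM₀ : 0 < M₀) (hM₁ : M₁ = 0) (hlam : lam = 0) :
    Tendsto (fun n => evenKernelValue n * (M₀ + oddKernelValue n * (M₀ * M₁ - lam ^ 2))
      / kernelDet M₀ M₁ lam (evenKernelValue n) (oddKernelValue n)) atTop (𝓝 1) := by
  have ia := tendsto_evenKernelValue.inv_tendsto_atTop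
  have h : Tendsto (fun n => M₀ / ((evenKernelValue n)⁻¹ + M₀)) atTop (𝓝 (M₀ / (0 + M₀))) :=
    tendsto_const_nhds.div (ia.add_const M₀) (by simpa using hM₀.ne')
  rw [zero_add, div_self hM₀.ne'] at h
  refine h.congr fun n => ?_
  have ha := evenKernelValue_pos n
  subst hM₁ hlam
  simp only [kernelDet, mul_zero, sub_zero, add_zero, ne_eq, OfNat.ofNat_ne_zero,
    not_false_eq_true, zero_pow]
  field_simp

/-- With `Δ = 0` the factor is `a M₀ / D ≤ (a/b) (M₀/M₁)`, and `a/b → 0`. -/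
lemma tendsto_even_factor_of_det_eq_zero (hM₀ : 0 ≤ M₀) (hM₁ : 0 < M₁)
    (hdet : M₀ * M₁ - lam ^ 2 = 0) :
    Tendsto (fun n => evenKernelValue n * (M₀ + oddKernelValue n * (M₀ * M₁ - lam ^ 2))
      / kernelDet M₀ M₁ lam (evenKernelValue n) (oddKernelValue n)) atTop (𝓝 0) := by
  have h0 := tendsto_evenKernelValue_div.mul_const (M₀ / M₁)
  rw [zero_mul] at h0
  refine squeeze_zero (fun n => ?_) (fun n => ?_) h0
  · have ha := evenKernelValue_pos n
    have hb := oddKernelValue_pos n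
    rw [kernelDet, hdet]; positivity
  · have ha := evenKernelValue_pos n
    have hb := oddKernelValue_pos n
    rw [kernelDet, hdet, mul_zero, add_zero, mul_zero, add_zero, div_mul_div_comm]
    gcongr
    nlinarith [mul_nonneg ha.le hM₀]

lemma oddKernelValue_div_kernelDet_le (hM₀ : 0 ≤ M₀) (hM₁ : 0 < M₁)
    (hdet : 0 ≤ M₀ * M₁ - lam ^ 2) {a b : ℝ} (ha : 0 < a) (hb : 0 < b) :
    b / kernelDet M₀ M₁ lam a b ≤ 1 / M₁ := by
  rw [div_le_div_iff₀ (kernelDet_pos hM₀ hM₁.le hdet ha.le hb.le) hM₁, kernelDet]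
  nlinarith [mul_nonneg ha.le hM₀, mul_nonneg (mul_nonneg ha.le hb.le) hdet]

lemma tendsto_inv_sqrt_succ :
    Tendsto (fun n : ℕ => (√((n + 1 : ℕ) : ℝ))⁻¹) atTop (𝓝 0) :=
  tendsto_sqrt_succ_atTop.inv_tendsto_atTop

lemma tendsto_even_cross_factor (hM₀ : 0 ≤ M₀) (hM₁ : 0 ≤ M₁) (hdet : 0 ≤ M₀ * M₁ - lam ^ 2) :
    Tendsto (fun n : ℕ => lam * oddKernelValue n /
      kernelDet M₀ M₁ lam (evenKernelValue n) (oddKernelValue n) / (2 * √((n + 1 : ℕ) : ℝ)))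
      atTop (𝓝 0) := by
  rcases hM₁.eq_or_lt with h | h
  -- Nonnegativity of the determinant with `M₁ = 0` forces `λ = 0`.
  · have : lam = 0 := by
      rw [← h] at hdet; nlinarith
    simp [this]
  · have h0 := tendsto_inv_sqrt_succ.const_mul (|lam| * (1 / M₁) / 2)
    rw [mul_zero] at h0
    refine squeeze_zero_norm (fun n => ?_) h0
    have ha := evenKernelValue_pos n
    have hb := oddKernelValue_pos n
    have hD := kernelDet_pos hM₀ hM₁ hdet ha.le hb.le
    have hle := oddKernelValue_div_kernelDet_le hM₀ h hdet ha hb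
    rw [mul_div_assoc, norm_div, norm_mul, Real.norm_of_nonneg (div_nonneg hb.le hD.le),
      Real.norm_of_nonneg (by positivity : (0 : ℝ) ≤ 2 * √((n + 1 : ℕ) : ℝ)), Real.norm_eq_abs,
      div_mul_eq_div_div, div_eq_mul_inv _ (√_)]
    gcongr

/-- One minus the factor is `(1 + a M₀) / D`, which vanishes because `b M₁ ≤ D` and `a/b → 0`. The
sign of `Δ` plays no role, so the odd limit does not see the rank once `M₁ > 0`. -/
lemma tendsto_odd_factor (hM₀ : 0 ≤ M₀) (hM₁ : 0 < M₁) (hdet : 0 ≤ M₀ * M₁ - lam ^ 2) :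
    Tendsto (fun n => oddKernelValue n * (M₁ + evenKernelValue (n + 1) * (M₀ * M₁ - lam ^ 2))
      / kernelDet M₀ M₁ lam (evenKernelValue (n + 1)) (oddKernelValue n)) atTop (𝓝 1) := by
  have ib := tendsto_oddKernelValue.inv_tendsto_atTop
  have hr : Tendsto (fun n => evenKernelValue (n + 1) / oddKernelValue n) atTop (𝓝 0) := by
    have h0 := tendsto_one_div_succ.const_mul (3 / 4)
    rw [mul_zero] at h0
    refine h0.congr fun n => ?_
    have := evenKernelValue_pos (n + 1)
    rw [oddKernelValue_eq_succ]
    field_simp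
  have h0 := (ib.add (hr.mul_const M₀)).mul_const (1 / M₁)
  rw [zero_mul, add_zero, zero_mul] at h0
  have h1 : Tendsto (fun n => (1 + evenKernelValue (n + 1) * M₀)
      / kernelDet M₀ M₁ lam (evenKernelValue (n + 1)) (oddKernelValue n)) atTop (𝓝 0) := by
    refine squeeze_zero (fun n => ?_) (fun n => ?_) h0
    · have ha := evenKernelValue_pos (n + 1)
      exact div_nonneg (by positivity)
        (kernelDet_pos hM₀ hM₁.le hdet ha.le (oddKernelValue_pos n).le).le
    · have ha := evenKernelValue_pos (n + 1)
      have hb := oddKernelValue_pos n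
      have hle := oddKernelValue_div_kernelDet_le hM₀ hM₁ hdet ha hb
      have e : (1 + evenKernelValue (n + 1) * M₀)
          / kernelDet M₀ M₁ lam (evenKernelValue (n + 1)) (oddKernelValue n)
          = ((oddKernelValue n)⁻¹ + evenKernelValue (n + 1) / oddKernelValue n * M₀)
            * (oddKernelValue n
              / kernelDet M₀ M₁ lam (evenKernelValue (n + 1)) (oddKernelValue n)) := by
        field_simp
      rw [e]
      exact mul_le_mul_of_nonneg_left hle (by positivity)
  have h2 := h1.const_sub 1
  rw [sub_zero] at h2
  refine h2.congr fun n => ?_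
  have hD := kernelDet_pos hM₀ hM₁.le hdet (evenKernelValue_pos (n + 1)).le
    (oddKernelValue_pos n).le
  rw [eq_div_iff hD.ne', sub_mul, div_mul_cancel₀ _ hD.ne', kernelDet]
  ring

lemma tendsto_odd_cross_factor (hM₀ : 0 ≤ M₀) (hM₁ : 0 ≤ M₁) (hdet : 0 ≤ M₀ * M₁ - lam ^ 2) :
    Tendsto (fun n : ℕ => 2 * √((n + 1 : ℕ) : ℝ) * (lam * evenKernelValue (n + 1) /
      kernelDet M₀ M₁ lam (evenKernelValue (n + 1)) (oddKernelValue n))) atTop (𝓝 0) := by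
  rcases hM₁.eq_or_lt with h | h
  · have : lam = 0 := by
      rw [← h] at hdet; nlinarith
    simp [this]
  · have h0 := tendsto_inv_sqrt_succ.const_mul (3 / 2 * |lam| * (1 / M₁))
    rw [mul_zero] at h0
    refine squeeze_zero_norm (fun n => ?_) h0
    have ha := evenKernelValue_pos (n + 1)
    have hb := oddKernelValue_pos n
    have hD := kernelDet_pos hM₀ hM₁ hdet ha.le hb.le
    have hle := oddKernelValue_div_kernelDet_le hM₀ h hdet ha hb
    have hs := Real.mul_self_sqrt (Nat.cast_nonneg (α := ℝ) (n + 1))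
    have hs0 : 0 < √((n + 1 : ℕ) : ℝ) := Real.sqrt_pos.2 (by positivity)
    -- From `b = (4/3)(n+1) a`, the product `√(n+1) a` is `(3/4) b / √(n+1)`, and `b / D` is
    -- bounded.
    have e : 2 * √((n + 1 : ℕ) : ℝ) * (lam * evenKernelValue (n + 1) /
        kernelDet M₀ M₁ lam (evenKernelValue (n + 1)) (oddKernelValue n))
        = 3 / 2 * lam * (oddKernelValue n
            / kernelDet M₀ M₁ lam (evenKernelValue (n + 1)) (oddKernelValue n))
          * (√((n + 1 : ℕ) : ℝ))⁻¹ := by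
      have e2 : oddKernelValue n
          = 4 / 3 * (√((n + 1 : ℕ) : ℝ) * √((n + 1 : ℕ) : ℝ)) * evenKernelValue (n + 1) := by
        rw [hs, oddKernelValue_eq_succ]
      generalize kernelDet M₀ M₁ lam (evenKernelValue (n + 1)) (oddKernelValue n) = D at *
      rw [e2]
      field_simp
      ring
    rw [e, norm_mul, norm_mul, norm_mul, Real.norm_of_nonneg (div_nonneg hb.le hD.le),
      Real.norm_of_nonneg (inv_nonneg.2 hs0.le), Real.norm_eq_abs lam,
      Real.norm_of_nonneg (by norm_num : (0 : ℝ) ≤ 3 / 2)]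
    gcongr

end Scalars

/-! ### Convergence of the scaled orthogonal polynomials -/

section Convergence

variable {M₀ M₁ lam : ℝ} {Q : ℕ → ℝ[X]}

lemma neg_one_pow_mul_hermiteValue (n : ℕ) :
    (-1) ^ n / (n ! : ℝ) * hermiteValue n = centralBinomRatio n := by
  have h : ((-1 : ℝ) ^ n) ^ 2 = 1 := by rw [← pow_mul, mul_comm, pow_mul]; simp
  have : (0 : ℝ) < n ! := by positivity
  unfold hermiteValue
  field_simp
  rw [h, one_mul]

/-- The explicit formulas are stated from index `n+1` on, so limits are taken along the shifted
sequence. -/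
lemma tendstoUniformlyOn_of_succ {F : ℕ → ℂ → ℂ} {g : ℂ → ℂ} {K : Set ℂ}
    (h : TendstoUniformlyOn (fun n => F (n + 1)) g atTop K) : TendstoUniformlyOn F g atTop K := by
  rw [Metric.tendstoUniformlyOn_iff] at *
  intro ε hε
  obtain ⟨N, hN⟩ := eventually_atTop.1 (h ε hε)
  refine eventually_atTop.2 ⟨N + 1, fun n hn => ?_⟩
  obtain ⟨k, rfl⟩ : ∃ k, n = k + 1 := ⟨n - 1, by omega⟩
  exact hN k (by omega)

lemma scaledEven_tendsto (hM₀ : 0 ≤ M₀) (hM₁ : 0 ≤ M₁) (hdet : 0 ≤ M₀ * M₁ - lam ^ 2)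
    (hQ : IsMonicOrthogonalSequence (massMatrix M₀ M₁ lam) Q) {B : ℝ}
    (hB : Tendsto (fun n => evenKernelValue n * (M₀ + oddKernelValue n * (M₀ * M₁ - lam ^ 2))
      / kernelDet M₀ M₁ lam (evenKernelValue n) (oddKernelValue n)) atTop (𝓝 B))
    {K : Set ℂ} (hK : IsCompact K) :
    TendstoUniformlyOn (scaledEven Q) (fun x => ((1 / √Real.pi : ℝ) : ℂ) *
      (paritySeries cosCoeff 0 x - (B : ℂ) * paritySeries sinCoeff 0 x)) atTop K := by
  refine tendstoUniformlyOn_of_succ ?_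
  have hA := tendsto_sqrt_mul_centralBinomRatio.comp (tendsto_add_atTop_nat 1)
  have hC := tendsto_even_cross_factor hM₀ hM₁ hdet
  have h1 := tendsto_mul_paritySeries hA 0 abs_cosCoeff_le
    (fun n j => descFactorial_weight_abs_le (le_refl (n + 1)) j)
    tendsto_descFactorial_succ_weight hK
  have h2 := tendsto_mul_paritySeries (hA.mul hB) 0 abs_sinCoeff_le
    (fun n j => descFactorial_weight_abs_le n.le_succ j) tendsto_descFactorial_weight hK
  have h3 := tendsto_mul_paritySeries (hA.mul hC) 1 abs_oddKernelCoeff_le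
    (fun n j => descFactorial_weight_abs_le n.le_succ j) tendsto_descFactorial_weight hK
  refine (((h1.sub h2).sub h3).congr ?_).congr_right ?_
  · refine Eventually.of_forall fun n x _ => ?_
    have hm : (0 : ℝ) < ((n + 1 : ℕ) : ℝ) := by positivity
    have hv := congrArg (fun r : ℝ => (r : ℂ)) (neg_one_pow_mul_hermiteValue (n + 1))
    simp only [Complex.ofReal_mul, Complex.ofReal_div, Complex.ofReal_pow, Complex.ofReal_neg,
      Complex.ofReal_one, Complex.ofReal_natCast] at hv
    simp only [scaledEven, hQ.even_eq hM₀ hM₁ hdet n, map_sub, map_mul, aeval_C,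
      aeval_monicHermite_even hm, aeval_evenKernel hm, aeval_oddKernel hm, Pi.sub_apply,
      Function.comp_apply, Complex.coe_algebraMap]
    simp only [Complex.ofReal_mul, Complex.ofReal_div, Nat.succ_eq_add_one, ← hv]
    ring
  · intro x _
    simp only [Pi.sub_apply]
    push_cast
    ring

lemma scaledOdd_tendsto (hM₀ : 0 ≤ M₀) (hM₁ : 0 ≤ M₁) (hdet : 0 ≤ M₀ * M₁ - lam ^ 2)
    (hQ : IsMonicOrthogonalSequence (massMatrix M₀ M₁ lam) Q) {B : ℝ}
    (hB : Tendsto (fun n => oddKernelValue n * (M₁ + evenKernelValue (n + 1) * (M₀ * M₁ - lam ^ 2))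
      / kernelDet M₀ M₁ lam (evenKernelValue (n + 1)) (oddKernelValue n)) atTop (𝓝 B))
    {K : Set ℂ} (hK : IsCompact K) :
    TendstoUniformlyOn (scaledOdd Q) (fun x => ((1 / √Real.pi : ℝ) : ℂ) *
      (paritySeries sinCoeff 1 x - (B : ℂ) * paritySeries oddKernelCoeff 1 x)) atTop K := by
  refine tendstoUniformlyOn_of_succ ?_
  have hA : Tendsto (fun n : ℕ => (2 * ((n + 1 : ℕ) : ℝ) + 1) * centralBinomRatio (n + 1)
      / (2 * √((n + 1 : ℕ) : ℝ))) atTop (𝓝 (1 / √Real.pi)) := by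
    -- With `m = n+1`, `(2m+1)/(2√m) = (1 + 1/(2m)) √m`, which reduces the limit to Wallis.
    have h1 := (tendsto_one_div_succ.const_mul (1 / 2)).const_add 1
    have h2 := h1.mul (tendsto_sqrt_mul_centralBinomRatio.comp (tendsto_add_atTop_nat 1))
    rw [mul_zero, add_zero, one_mul] at h2
    refine h2.congr fun n => ?_
    have hs := Real.sq_sqrt (Nat.cast_nonneg (α := ℝ) (n + 1))
    have hs0 : 0 < √((n + 1 : ℕ) : ℝ) := Real.sqrt_pos.2 (by positivity)
    simp only [Function.comp_apply]
    generalize √((n + 1 : ℕ) : ℝ) = s at *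
    rw [← hs]
    field_simp
  have hC := tendsto_odd_cross_factor hM₀ hM₁ hdet
  have h1 := tendsto_mul_paritySeries hA 1 abs_sinCoeff_le
    (fun n j => descFactorial_weight_abs_le (le_refl (n + 1)) j)
    tendsto_descFactorial_succ_weight hK
  have h2 := tendsto_mul_paritySeries (hA.mul hC) 0 abs_sinCoeff_le
    (fun n j => descFactorial_weight_abs_le (le_refl (n + 1)) j)
    tendsto_descFactorial_succ_weight hK
  have h3 := tendsto_mul_paritySeries (hA.mul hB) 1 abs_oddKernelCoeff_le
    (fun n j => descFactorial_weight_abs_le n.le_succ j) tendsto_descFactorial_weight hK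
  refine (((h1.sub h2).sub h3).congr ?_).congr_right ?_
  · refine Eventually.of_forall fun n x _ => ?_
    have hm : (0 : ℝ) < ((n + 1 : ℕ) : ℝ) := by positivity
    have hs0 : ((√((n + 1 : ℕ) : ℝ) : ℝ) : ℂ) ≠ 0 := by
      exact_mod_cast (Real.sqrt_pos.2 hm).ne'
    have hv := congrArg (fun r : ℝ => (r : ℂ)) (neg_one_pow_mul_hermiteValue (n + 1))
    simp only [Complex.ofReal_mul, Complex.ofReal_div, Complex.ofReal_pow, Complex.ofReal_neg,
      Complex.ofReal_one, Complex.ofReal_natCast] at hv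
    simp only [scaledOdd, hQ.odd_eq hM₀ hM₁ hdet n, map_sub, map_mul, aeval_C,
      aeval_monicHermite_odd hm, aeval_evenKernel hm, aeval_oddKernel hm, Pi.sub_apply,
      Complex.coe_algebraMap]
    simp only [Complex.ofReal_mul, Complex.ofReal_div, Complex.ofReal_add, Complex.ofReal_ofNat,
      Complex.ofReal_one, Nat.succ_eq_add_one, ← hv]
    field_simp
  · intro x _
    simp only [Pi.sub_apply]
    push_cast
    ring

lemma scaledEven_converges_neg_half (hM₀ : 0 ≤ M₀) (hM₁ : 0 < M₁)
    (hdet : M₀ * M₁ - lam ^ 2 = 0)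
    (hQ : IsMonicOrthogonalSequence (massMatrix M₀ M₁ lam) Q) :
    ConvergesToBessel (scaledEven Q) 1 (-1 / 2) := by
  refine ⟨fun x => ((1 / √Real.pi : ℝ) : ℂ) *
      (paritySeries cosCoeff 0 x - ((0 : ℝ) : ℂ) * paritySeries sinCoeff 0 x), ?_,
    fun x hx => ?_, fun K hK => scaledEven_tendsto hM₀ hM₁.le hdet.ge hQ
      (tendsto_even_factor_of_det_eq_zero hM₀ hM₁ hdet) hK⟩
  · exact ((differentiable_paritySeries abs_cosCoeff_le 0).sub
      ((differentiable_paritySeries abs_sinCoeff_le 0).const_mul _)).const_mul _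
  · rw [← bessel_neg_half hx]; simp

lemma scaledEven_converges_three_halves (hM₀ : 0 ≤ M₀) (hM₁ : 0 ≤ M₁)
    (hdet : 0 ≤ M₀ * M₁ - lam ^ 2)
    (hQ : IsMonicOrthogonalSequence (massMatrix M₀ M₁ lam) Q)
    (hB : Tendsto (fun n => evenKernelValue n * (M₀ + oddKernelValue n * (M₀ * M₁ - lam ^ 2))
      / kernelDet M₀ M₁ lam (evenKernelValue n) (oddKernelValue n)) atTop (𝓝 1)) :
    ConvergesToBessel (scaledEven Q) (-1) (3 / 2) := by
  refine ⟨fun x => ((1 / √Real.pi : ℝ) : ℂ) *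
      (paritySeries cosCoeff 0 x - ((1 : ℝ) : ℂ) * paritySeries sinCoeff 0 x), ?_,
    fun x hx => ?_, fun K hK => scaledEven_tendsto hM₀ hM₁ hdet hQ hB hK⟩
  · exact ((differentiable_paritySeries abs_cosCoeff_le 0).sub
      ((differentiable_paritySeries abs_sinCoeff_le 0).const_mul _)).const_mul _
  · rw [← bessel_three_halves hx]; simp

lemma scaledOdd_converges_half (hM₀ : 0 ≤ M₀) (hM₁ : M₁ = 0) (hlam : lam = 0)
    (hQ : IsMonicOrthogonalSequence (massMatrix M₀ M₁ lam) Q) :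
    ConvergesToBessel (scaledOdd Q) 1 (1 / 2) := by
  subst hM₁ hlam
  -- With `M₁ = λ = 0` the odd factor is identically zero, so `B = 0`.
  refine ⟨fun x => ((1 / √Real.pi : ℝ) : ℂ) *
      (paritySeries sinCoeff 1 x - ((0 : ℝ) : ℂ) * paritySeries oddKernelCoeff 1 x), ?_,
    fun x hx => ?_, fun K hK => scaledOdd_tendsto hM₀ le_rfl (by simp) hQ (by simp) hK⟩
  · exact ((differentiable_paritySeries abs_sinCoeff_le 1).sub
      ((differentiable_paritySeries abs_oddKernelCoeff_le 1).const_mul _)).const_mul _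
  · rw [← bessel_half hx]; simp

lemma scaledOdd_converges_five_halves (hM₀ : 0 ≤ M₀) (hM₁ : 0 < M₁)
    (hdet : 0 ≤ M₀ * M₁ - lam ^ 2)
    (hQ : IsMonicOrthogonalSequence (massMatrix M₀ M₁ lam) Q) :
    ConvergesToBessel (scaledOdd Q) (-1) (5 / 2) := by
  refine ⟨fun x => ((1 / √Real.pi : ℝ) : ℂ) *
      (paritySeries sinCoeff 1 x - ((1 : ℝ) : ℂ) * paritySeries oddKernelCoeff 1 x), ?_,
    fun x hx => ?_, fun K hK => scaledOdd_tendsto hM₀ hM₁.le hdet hQ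
      (tendsto_odd_factor hM₀ hM₁ hdet) hK⟩
  · exact ((differentiable_paritySeries abs_sinCoeff_le 1).sub
      ((differentiable_paritySeries abs_oddKernelCoeff_le 1).const_mul _)).const_mul _
  · rw [← bessel_five_halves hx]; simp

end Convergence

/-! ### Rank, determinant and the case analysis -/

lemma det_massMatrix (M₀ M₁ lam : ℝ) : (massMatrix M₀ M₁ lam).det = M₀ * M₁ - lam ^ 2 := by
  rw [massMatrix, Matrix.det_fin_two_of]; ring

lemma det_eq_zero_of_rank_massMatrix {M₀ M₁ lam : ℝ} (h : (massMatrix M₀ M₁ lam).rank = 1) :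
    M₀ * M₁ - lam ^ 2 = 0 := by
  by_contra hne
  rw [← det_massMatrix] at hne
  rw [Matrix.rank_of_det_ne_zero hne] at h
  simp at h

lemma det_ne_zero_of_rank_massMatrix {M₀ M₁ lam : ℝ} (h : (massMatrix M₀ M₁ lam).rank = 2) :
    M₀ * M₁ - lam ^ 2 ≠ 0 := by
  rw [← det_massMatrix]
  have hli : LinearIndependent ℝ (massMatrix M₀ M₁ lam).row := by
    rw [linearIndependent_iff_card_eq_finrank_span, Set.finrank, ← Matrix.rank_eq_finrank_span_row,
      h]
    simp
  exact ((Matrix.isUnit_iff_isUnit_det _).1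
    (Matrix.linearIndependent_rows_iff_isUnit.1 hli)).ne_zero

end

theorem theorem1 (M₀ M₁ lam : ℝ) (hM₀ : 0 ≤ M₀) (hM₁ : 0 ≤ M₁)
    (hdet : 0 ≤ M₀ * M₁ - lam ^ 2) (hA : massMatrix M₀ M₁ lam ≠ 0)
    (Q : ℕ → Polynomial ℝ) (hQ : IsMonicOrthogonalSequence (massMatrix M₀ M₁ lam) Q) :
    -- even degree, diagonal case
    (lam = 0 →
      ((massMatrix M₀ M₁ lam).rank = 1 → M₀ = 0 →
        ConvergesToBessel (scaledEven Q) 1 (-1 / 2)) ∧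
      ((massMatrix M₀ M₁ lam).rank = 1 → 0 < M₀ →
        ConvergesToBessel (scaledEven Q) (-1) (3 / 2)) ∧
      ((massMatrix M₀ M₁ lam).rank = 2 →
        ConvergesToBessel (scaledEven Q) (-1) (3 / 2))) ∧
    -- even degree, nondiagonal case
    (lam ≠ 0 →
      ((massMatrix M₀ M₁ lam).rank = 1 →
        ConvergesToBessel (scaledEven Q) 1 (-1 / 2)) ∧
      ((massMatrix M₀ M₁ lam).rank = 2 →
        ConvergesToBessel (scaledEven Q) (-1) (3 / 2))) ∧
    -- odd degree, diagonal case
    (lam = 0 →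
      ((massMatrix M₀ M₁ lam).rank = 1 → M₁ = 0 →
        ConvergesToBessel (scaledOdd Q) 1 (1 / 2)) ∧
      ((massMatrix M₀ M₁ lam).rank = 1 → 0 < M₁ →
        ConvergesToBessel (scaledOdd Q) (-1) (5 / 2)) ∧
      ((massMatrix M₀ M₁ lam).rank = 2 →
        ConvergesToBessel (scaledOdd Q) (-1) (5 / 2))) ∧
    -- odd degree, nondiagonal case
    (lam ≠ 0 →
      ((massMatrix M₀ M₁ lam).rank = 1 →
        ConvergesToBessel (scaledOdd Q) (-1) (5 / 2)) ∧
      ((massMatrix M₀ M₁ lam).rank = 2 →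
        ConvergesToBessel (scaledOdd Q) (-1) (5 / 2))) := by

  have pos_of_det : 0 < M₀ * M₁ - lam ^ 2 → 0 < M₁ := fun h =>
    hM₁.lt_of_ne fun h0 => by rw [← h0] at h; nlinarith
  -- If `M₁ = 0` then `-λ² ≥ 0`, impossible for `λ ≠ 0`; hence the off-diagonal cases always have
  -- `M₁ > 0`.
  have pos_of_lam : lam ≠ 0 → 0 < M₁ := fun h =>
    hM₁.lt_of_ne fun h0 => by
      have := pow_pos (abs_pos.2 h) 2
      rw [sq_abs] at this
      rw [← h0] at hdet; linarith
  have det_pos : (massMatrix M₀ M₁ lam).rank = 2 → 0 < M₀ * M₁ - lam ^ 2 := fun h =>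
    hdet.lt_of_ne (det_ne_zero_of_rank_massMatrix h).symm
  have even_two : (massMatrix M₀ M₁ lam).rank = 2 →
      ConvergesToBessel (scaledEven Q) (-1) (3 / 2) := fun h =>
    scaledEven_converges_three_halves hM₀ hM₁ hdet hQ
      (tendsto_even_factor_of_det_pos hM₀ hM₁ (det_pos h))
  have odd_two : (massMatrix M₀ M₁ lam).rank = 2 →
      ConvergesToBessel (scaledOdd Q) (-1) (5 / 2) := fun h =>
    scaledOdd_converges_five_halves hM₀ (pos_of_det (det_pos h)) hdet hQ
  refine ⟨fun hl => ⟨fun hr h0 => ?_, fun hr h0 => ?_, even_two⟩,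
    fun hl => ⟨fun hr => ?_, even_two⟩,
    fun hl => ⟨fun hr h1 => ?_, fun hr h1 => ?_, odd_two⟩,
    fun hl => ⟨fun hr => ?_, odd_two⟩⟩
  · have h1 : 0 < M₁ := hM₁.lt_of_ne fun h1 => hA (by
      ext i j
      fin_cases i <;> fin_cases j <;> simp [massMatrix, hl, h0, ← h1])
    exact scaledEven_converges_neg_half hM₀ h1 (det_eq_zero_of_rank_massMatrix hr) hQ
  · have h1 : M₁ = 0 := by
      have := det_eq_zero_of_rank_massMatrix hr
      rw [hl] at this
      rcases mul_eq_zero.1 (by linarith : M₀ * M₁ = 0) with h | h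
      · exact absurd h h0.ne'
      · exact h
    exact scaledEven_converges_three_halves hM₀ hM₁ hdet hQ (tendsto_even_factor_of_pos h0 h1 hl)
  · exact scaledEven_converges_neg_half hM₀ (pos_of_lam hl) (det_eq_zero_of_rank_massMatrix hr) hQ
  · exact scaledOdd_converges_half hM₀ h1 hl hQ
  · exact scaledOdd_converges_five_halves hM₀ h1 hdet hQ
  · exact scaledOdd_converges_five_halves hM₀ (pos_of_lam hl) hdet hQ
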